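/- There is an absolute constant $c>0$ such that the following holds. Let $m,n\ge 1$, and let $\mathbf r\in\mathbb R^m$, $\mathbf c\in\mathbb R^n$ be vectors with common total $N:=\sum_i\mathbf r(i)=\sum_j\mathbf c(j)>0$ which are $\delta$-smooth for some $\delta>0$: $\frac{\delta N}{m}\le \mathbf r(i)\le\frac{N}{\delta m}$ and $\frac{\delta N}{n}\le\mathbf c(j)\le\frac{N}{\delta n}$ for all $i,j$. Let $X$ be a random $m\times n$ matrix with independent nonnegative entries and entrywise positive mean $\Lambda=\mathbb E[X]$, and let $\sigma,R>0$ be such that $\mathbb E|X_{ij}-\Lambda_{ij}|^q\le\frac{q!}{2}\sigma^2R^{q-2}$ for all $i,j$ and all integers $q\ge2$. Let $\|\cdot\|_2$ denote the spectral norm and $\|A\|_1=\sum_{i,j}|A_{ij}|$, and let $K\ge0$ be such that $\bigl|\log\frac{\mathbf r(i)\mathbf c(j)\|\Lambda\|_1}{\Lambda_{ij}N^2}\bigr|\le K$ for all $i,j$. Let $\mathcal T(\mathbf r,\mathbf c)$ be the set of nonnegative $m\times n$ matrices with row sums $\mathbf r$ and column sums $\mathbf c$, and $\mathcal S(\mathbf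 r,\mathbf c)$ the set of nonnegative $m\times n$ matrices $A$ for which $D_1AD_2\in\mathcal T(\mathbf r,\mathbf c)$ for some positive diagonal matrices $D_1,D_2$. Write $\mathbf D(e^{\alpha})$ for the diagonal matrix with diagonal entries $e^{\alpha(i)}$; vectors $(\alpha,\beta)\in\mathbb R^m\times\mathbb R^n$ are called (Schrödinger) potentials of $A$ if $\mathbf D(e^\alpha)A\,\mathbf D(e^\beta)\in\mathcal T(\mathbf r,\mathbf c)$. Fix $D>0$ and put $$\tau=(D+1)\log(m\vee n)+\log4,\qquad t_D=\sigma\sqrt{2(m\vee n)\tau}+2R\tau,\qquad \varepsilon_0=\frac{e^{2K}(m\vee n)}{\delta\|\Lambda\|_1}\,t_D,$$ $$C_*=1+\frac{18e^{8K}\|\Lambda\|_1^2}{\delta^2\Lambda_{\min}^2m^2n^2},\qquad \varepsilon_{\mathrm{pot}}=16C_*\varepsilon_0,\qquad \Phi_\Lambda=\min\Bigl(\frac{n\Lambda_{\min}^4}{(\sigma+R+\Lambda_{\max})^4},\ \frac{\sqrt n\,\Lambda_{\min}}{\sigma+R+\Lambda_{\max}}\Bigr),$$ where $\Lambda_{\min}$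 and $\Lambda_{\max}$ are the smallest and largest entries of $\Lambda$. Suppose $\varepsilon_0\le\frac1{50C_*^2}$. Then $\varepsilon_{\mathrm{pot}}\le1$, potentials of $\Lambda$ exist, and for all potentials $(\alpha,\beta)$ of $\Lambda$ the following two bounds hold. 1. Let $\mathcal E_2$ be the event that $X\in\mathcal S(\mathbf r,\mathbf c)$ and, for all potentials $(\alpha_X,\beta_X)$ of $X$, $$\tfrac1N\bigl\|\mathbf D(e^{\alpha_X})(X-\Lambda)\mathbf D(e^{\beta_X})-\mathbf D(e^{\alpha})(X-\Lambda)\mathbf D(e^{\beta})\bigr\|_2\le\frac{3e^{2K}\varepsilon_{\mathrm{pot}}t_D}{\|\Lambda\|_1}.$$ Then $\mathbb P(\mathcal E_2)\ge1-2(m\vee n)^{-D}-m^2\exp(-c\,\Phi_\Lambda)$. 2. Let $\mathcal E_3$ be the event that $X\in\mathcal S(\mathbf r,\mathbf c)$ and, for all potentials $(\alpha_X,\beta_X)$ of $X$, the rescaled matrix $X^{\mathbf r,\mathbf c}=\mathbf D(e^{\alpha_X})X\mathbf D(e^{\beta_X})$ satisfies $$\tfrac1N\bigl\|X^{\mathbf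 r,\mathbf c}-\mathbf D(e^{\alpha})X\mathbf D(e^{\beta})\bigr\|_1\le2\varepsilon_{\mathrm{pot}}e^{2K}.$$ Then $$\mathbb P(\mathcal E_3)\ge1-(m\vee n)^{-D}-m^2\exp(-c\,\Phi_\Lambda)-2\exp\Bigl(-\frac{\|\Lambda\|_1^2/2}{mn\sigma^2+R\|\Lambda\|_1}\Bigr).$$ -/

import Mathlib

open MeasureTheory ProbabilityTheory

noncomputable section

namespace SinkhornRescaling

/-- The total mass `‖A‖₁ = ∑ i j, |A i j|` (entrywise `ℓ¹` norm). -/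
def entryL1 {m n : ℕ} (A : Matrix (Fin m) (Fin n) ℝ) : ℝ :=
  ∑ i, ∑ j, |A i j|

open scoped Matrix.Norms.L2Operator in
/-- The spectral norm `‖A‖₂`: the operator norm from Euclidean `ℝⁿ` to Euclidean `ℝᵐ`. -/
def spectralNorm {m n : ℕ} (A : Matrix (Fin m) (Fin n) ℝ) : ℝ := ‖A‖

/-- The transportation polytope `T(r, c)`: nonnegative matrices with row sums `r` and
column sums `c`. -/
def transportPolytope {m n : ℕ} (r : Fin m → ℝ) (c : Fin n → ℝ) :
    Set (Matrix (Fin m) (Fin n) ℝ) :=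
  {A | (∀ i j, 0 ≤ A i j) ∧ (∀ i, ∑ j, A i j = r i) ∧ (∀ j, ∑ i, A i j = c j)}

/-- `S(r, c)`: nonnegative matrices `A` for which there are positive diagonal matrices
`D₁`, `D₂` with `D₁ A D₂ ∈ T(r, c)`. -/
def scalable {m n : ℕ} (r : Fin m → ℝ) (c : Fin n → ℝ) :
    Set (Matrix (Fin m) (Fin n) ℝ) :=
  {A | (∀ i j, 0 ≤ A i j) ∧
    ∃ (d₁ : Fin m → ℝ) (d₂ : Fin n → ℝ), (∀ i, 0 < d₁ i) ∧ (∀ j, 0 < d₂ j) ∧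
      Matrix.diagonal d₁ * A * Matrix.diagonal d₂ ∈ transportPolytope r c}

/-- `D(e^α) A D(e^β)`. -/
def rescale {m n : ℕ} (α : Fin m → ℝ) (A : Matrix (Fin m) (Fin n) ℝ) (β : Fin n → ℝ) :
    Matrix (Fin m) (Fin n) ℝ :=
  Matrix.diagonal (fun i => Real.exp (α i)) * A * Matrix.diagonal (fun j => Real.exp (β j))

/-- `(α, β)` are Schrödinger potentials of `A` for the margin `(r, c)`:
`D(e^α) A D(e^β) ∈ T(r, c)`. -/
def IsPotentials {m n : ℕ} (A : Matrix (Fin m) (Fin n) ℝ) (r : Fin m → ℝ) (c : Fin n → ℝ)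
    (α : Fin m → ℝ) (β : Fin n → ℝ) : Prop :=
  rescale α A β ∈ transportPolytope r c

/-- `(r, c)` is a `δ`-smooth margin, with positive total mass `N = ∑ i, r i = ∑ j, c j`.
All entries of `r` and `c` are then positive. -/
structure IsSmoothMargin {m n : ℕ} (r : Fin m → ℝ) (c : Fin n → ℝ) (δ : ℝ) : Prop where
  delta_pos : 0 < δ
  total_pos : 0 < ∑ i, r i
  total_eq : ∑ i, r i = ∑ j, c j
  row : ∀ i, δ * (∑ i, r i) / m ≤ r i ∧ r i ≤ (∑ i, r i) / (δ * m)
  col : ∀ j, δ * (∑ i, r i) / n ≤ c j ∧ c j ≤ (∑ i, r i) / (δ * n)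

/-- `X` is a random matrix with independent nonnegative entries, positive mean `Λ`, and
`E|X i j - Λ i j|^q ≤ (q!/2) σ² R^(q-2)` for all integers `q ≥ 2`. -/
structure IsSubexponential {Ω : Type*} [MeasurableSpace Ω] (μ : Measure Ω) {m n : ℕ}
    (X : Ω → Matrix (Fin m) (Fin n) ℝ) (Λ : Matrix (Fin m) (Fin n) ℝ) (σ R : ℝ) : Prop where
  measurable : ∀ i j, Measurable (fun ω => X ω i j)
  nonneg : ∀ᵐ ω ∂μ, ∀ i j, 0 ≤ X ω i j
  indep : iIndepFun (fun (p : Fin m × Fin n) (ω : Ω) => X ω p.1 p.2) μ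
  integrable : ∀ i j, Integrable (fun ω => X ω i j) μ
  mean : ∀ i j, ∫ ω, X ω i j ∂μ = Λ i j
  mean_pos : ∀ i j, 0 < Λ i j
  sigma_pos : 0 < σ
  R_pos : 0 < R
  moment_integrable : ∀ i j, ∀ q : ℕ, 2 ≤ q → Integrable (fun ω => |X ω i j - Λ i j| ^ q) μ
  moment_le : ∀ i j, ∀ q : ℕ, 2 ≤ q →
    ∫ ω, |X ω i j - Λ i j| ^ q ∂μ ≤ (q.factorial : ℝ) / 2 * σ ^ 2 * R ^ (q - 2)

/-- The bounded cost condition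
`|log (r i * c j * ‖Λ‖₁ / (Λ i j * N ^ 2))| ≤ K` with `N = ∑ i, r i`. -/
structure IsBoundedCost {m n : ℕ} (Λ : Matrix (Fin m) (Fin n) ℝ) (r : Fin m → ℝ)
    (c : Fin n → ℝ) (K : ℝ) : Prop where
  K_nonneg : 0 ≤ K
  bound : ∀ i j, |Real.log (r i * c j * entryL1 Λ / (Λ i j * (∑ i, r i) ^ 2))| ≤ K

/-- `m ∨ n` as a real number. -/
def maxDim (m n : ℕ) : ℝ := max (m : ℝ) (n : ℝ)

/-- `τ = (D + 1) log (m ∨ n) + log 4`. -/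
def tau (m n : ℕ) (D : ℝ) : ℝ := (D + 1) * Real.log (maxDim m n) + Real.log 4

/-- `t_D = σ √(2 (m ∨ n) τ) + 2 R τ`. -/
def tD (m n : ℕ) (σ R D : ℝ) : ℝ :=
  σ * Real.sqrt (2 * maxDim m n * tau m n D) + 2 * R * tau m n D

/-- `Λ_min`. -/
def entryMin {m n : ℕ} (Λ : Matrix (Fin m) (Fin n) ℝ) : ℝ :=
  ⨅ p : Fin m × Fin n, Λ p.1 p.2

/-- `Λ_max`. -/
def entryMax {m n : ℕ} (Λ : Matrix (Fin m) (Fin n) ℝ) : ℝ :=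
  ⨆ p : Fin m × Fin n, Λ p.1 p.2

/-- `ε₀ = e^{2K} (m ∨ n) / (δ ‖Λ‖₁) * (σ √(2 (m ∨ n) τ) + 2 R τ)`. -/
def eps0 {m n : ℕ} (Λ : Matrix (Fin m) (Fin n) ℝ) (δ K σ R D : ℝ) : ℝ :=
  Real.exp (2 * K) * maxDim m n / (δ * entryL1 Λ) *
    (σ * Real.sqrt (2 * maxDim m n * tau m n D) + 2 * R * tau m n D)

/-- `C_* = 1 + 18 e^{8K} ‖Λ‖₁² / (δ² Λ_min² m² n²)`. -/
def Cstar {m n : ℕ} (Λ : Matrix (Fin m) (Fin n) ℝ) (δ K : ℝ) : ℝ :=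
  1 + 18 * Real.exp (8 * K) * entryL1 Λ ^ 2 /
    (δ ^ 2 * entryMin Λ ^ 2 * (m : ℝ) ^ 2 * (n : ℝ) ^ 2)

/-- `ε_pot = 16 C_* ε₀`. -/
def epsPot {m n : ℕ} (Λ : Matrix (Fin m) (Fin n) ℝ) (δ K σ R D : ℝ) : ℝ :=
  16 * Cstar Λ δ K * eps0 Λ δ K σ R D

/-- The row-alignment rate `Φ_Λ`. -/
def alignRate {m n : ℕ} (Λ : Matrix (Fin m) (Fin n) ℝ) (σ R : ℝ) : ℝ :=
  min (n * (entryMin Λ ^ 4 / (σ + R + entryMax Λ) ^ 4))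
    (Real.sqrt n * (entryMin Λ / (σ + R + entryMax Λ)))

/-- The event that `X` is scalable and the rescaled noise `D(e^{α_X}) (X - Λ) D(e^{β_X})` is
within `N * 3 e^{2K} ε_pot t_D / ‖Λ‖₁` of `D(e^α) (X - Λ) D(e^β)` in spectral norm. Potentials
of `X` may fail to be unique for exceptional realizations of `X`; the event asks for the
bound for every choice of them. -/
def eventSpectral {Ω : Type*} {m n : ℕ} (X : Ω → Matrix (Fin m) (Fin n) ℝ)
    (Λ : Matrix (Fin m) (Fin n) ℝ) (r : Fin m → ℝ) (c : Fin n → ℝ)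
    (α : Fin m → ℝ) (β : Fin n → ℝ) (δ K σ R D : ℝ) : Set Ω :=
  {ω | X ω ∈ scalable r c ∧
    ∀ (αX : Fin m → ℝ) (βX : Fin n → ℝ), IsPotentials (X ω) r c αX βX →
      1 / (∑ i, r i) * spectralNorm (rescale αX (X ω - Λ) βX - rescale α (X ω - Λ) β)
        ≤ 3 * Real.exp (2 * K) * epsPot Λ δ K σ R D * tD m n σ R D / entryL1 Λ}

/-- The event that `X` is scalable and the rescaled matrix `X^{r,c} = D(e^{α_X}) X D(e^{β_X})` is
within `N * 2 ε_pot e^{2K}` of the comparison model `D(e^α) X D(e^β)` in entrywise `ℓ¹` norm. -/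
def eventL1 {Ω : Type*} {m n : ℕ} (X : Ω → Matrix (Fin m) (Fin n) ℝ)
    (Λ : Matrix (Fin m) (Fin n) ℝ) (r : Fin m → ℝ) (c : Fin n → ℝ)
    (α : Fin m → ℝ) (β : Fin n → ℝ) (δ K σ R D : ℝ) : Set Ω :=
  {ω | X ω ∈ scalable r c ∧
    ∀ (αX : Fin m → ℝ) (βX : Fin n → ℝ), IsPotentials (X ω) r c αX βX →
      1 / (∑ i, r i) * entryL1 (rescale αX (X ω) βX - rescale α (X ω) β)
        ≤ 2 * epsPot Λ δ K σ R D * Real.exp (2 * K)}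

end SinkhornRescaling

end

/-! Put `A = D(e^α) X D(e^β)`, where `(α, β)` are potentials of `Λ`. The mean of `A` has margins
exactly `(r, c)`, so `X` should need only a small further correction `(a, b)`, and both events
follow once `a` and `b` are uniformly small. Probability enters through three facts only: the
weighted row and column sums of `X - Λ` are at most `t_D`, the spectral norm of `X - Λ` is at most
`t_D`, and any two rows of `X` have inner product at least of order `n Λ_min²`.

The first two facts come from one moment argument (`taylorSum_walk_le`). With `ψ(t) = σ² t² / (2 (1
- R t))`, the moment hypothesis bounds the moments of an entry by the derivatives of `ψ` at `0`. For
walks on a graph of degree at most `M` with independent edge weights, the exponential generating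
function of the expected walk sums is dominated by `exp (M ψ(t))`. Loops at a single vertex give the
scalar Bernstein inequality; closed walks on the complete bipartite graph give traces of powers of
`Y Yᵀ`, hence the spectral norm, with `M = m ∨ n`. The third fact is a lower tail bound for sums of
nonnegative variables (`measureReal_row_inner_le`).

The rest is deterministic. The bounded cost condition confines `e^(α i + β j)` between `e^(-3K) N /
‖Λ‖₁` and `e^(2K) N / ‖Λ‖₁` (`IsPotentials.exp_bounds`), so the margins of `A` have relative error
at most `ε₀`. Eliminating the column potentials leaves a fixed point problem for one Sinkhorn step
on row potentials. The Jacobian of that step is a stochastic matrix, and alignment of rows bounds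
its entries below, so by Doeblin the step contracts oscillation by a definite factor. It moves `0`
by `O(ε₀)`, hence has a fixed point of size `O(C_* ε₀)` (`SinkhornData.exists_isPotentials_near`).
Potentials are unique up to a shift because rows of `X` overlap pairwise
(`IsPotentials.add_eq_add`), so the estimate holds for all of them (`potentials_close`). Perturbing
the exponentials then gives both bounds. -/

noncomputable section

namespace SinkhornRescaling

/-! ### Moments of walk sums with independent edge weights -/

section WalkMoments

/-- The `j`-th derivative of `t ↦ σ² t² / (2 (1 - R t))`. -/
def bernsteinDeriv (σ R : ℝ) (j : ℕ) (t : ℝ) : ℝ :=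
  σ ^ 2 / (2 * R ^ 2) * (j.factorial * R ^ j * ((1 - R * t) ^ (j + 1))⁻¹
    - (if j = 0 then 1 + R * t else if j = 1 then R else 0))

lemma hasDerivAt_bernsteinDeriv (σ R : ℝ) (j : ℕ) {t : ℝ} (ht : R * t < 1) :
    HasDerivAt (bernsteinDeriv σ R j) (bernsteinDeriv σ R (j + 1) t) t := by
  have hne : (1 - R * t) ≠ 0 := by linarith
  have h1 : HasDerivAt (fun t => 1 - R * t) (-R) t := by
    simpa using ((hasDerivAt_id t).const_mul R).const_sub 1
  have h2 := ((h1.fun_pow (j + 1)).fun_inv (pow_ne_zero _ hne)).const_mul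
    ((j.factorial : ℝ) * R ^ j)
  have h3 : HasDerivAt (fun t : ℝ => (if j = 0 then 1 + R * t else if j = 1 then R else 0))
      (if j = 0 then R else 0) t := by
    rcases eq_or_ne j 0 with rfl | hj
    · simpa using ((hasDerivAt_id t).const_mul R).const_add 1
    · simpa [hj] using hasDerivAt_const t _
  have h4 := (h2.fun_sub h3).const_mul (σ ^ 2 / (2 * R ^ 2))
  refine h4.congr_deriv ?_
  unfold bernsteinDeriv
  rw [Nat.factorial_succ]
  push_cast
  congr 2
  field_simp
  ring

lemma bernsteinDeriv_zero {σ R t : ℝ} (hR : R ≠ 0) (ht : R * t < 1) :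
    bernsteinDeriv σ R 0 t = σ ^ 2 * t ^ 2 / (2 * (1 - R * t)) := by
  have hne : (1 - R * t) ≠ 0 := by linarith
  simp only [bernsteinDeriv, Nat.factorial_zero, if_true]
  field_simp
  ring

/-- This matches the vanishing mean of a centred entry; from order two on, the derivatives at `0`
reproduce the moment hypothesis exactly. -/
lemma bernsteinDeriv_at_zero_one (σ R : ℝ) : bernsteinDeriv σ R 1 0 = 0 := by
  simp [bernsteinDeriv]

lemma bernsteinDeriv_at_zero {σ R : ℝ} (hR : R ≠ 0) {j : ℕ} (hj : 2 ≤ j) :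
    bernsteinDeriv σ R j 0 = j.factorial / 2 * σ ^ 2 * R ^ (j - 2) := by
  obtain ⟨i, rfl⟩ := Nat.exists_eq_add_of_le hj
  simp only [bernsteinDeriv, Nat.add_sub_cancel_left]
  rw [if_neg (by omega), if_neg (by omega)]
  field_simp
  ring

lemma bernsteinDeriv_nonneg (σ : ℝ) {R t : ℝ} (hR : 0 < R) (ht0 : 0 ≤ t) (ht : R * t < 1)
    {j : ℕ} (hj : 1 ≤ j) : 0 ≤ bernsteinDeriv σ R j t := by
  have h0 : 0 < 1 - R * t := by linarith
  have h1 : 1 - R * t ≤ 1 := by nlinarith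
  unfold bernsteinDeriv
  refine mul_nonneg (by positivity) ?_
  rw [if_neg (by omega)]
  split_ifs with h
  · subst h
    have : 1 ≤ ((1 - R * t) ^ (1 + 1))⁻¹ := (one_le_inv₀ (by positivity)).2 (pow_le_one₀ h0.le h1)
    simp only [Nat.factorial_one, Nat.cast_one, one_mul, pow_one]
    nlinarith
  · rw [sub_zero]
    positivity

/-- The bound for the moment of order `k` of one edge weight, evaluated at time `t`. -/
def edgeFactor (σ R : ℝ) (k : ℕ) (t : ℝ) : ℝ := if k = 0 then 1 else bernsteinDeriv σ R k t

lemma edgeFactor_nonneg (σ : ℝ) {R t : ℝ} (hR : 0 < R) (ht0 : 0 ≤ t) (ht : R * t < 1) (k : ℕ) :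
    0 ≤ edgeFactor σ R k t := by
  unfold edgeFactor
  split_ifs with h
  · exact zero_le_one
  · exact bernsteinDeriv_nonneg σ hR ht0 ht (by omega)

lemma hasDerivAt_edgeFactor (σ R : ℝ) (k : ℕ) {t : ℝ} (ht : R * t < 1) :
    HasDerivAt (edgeFactor σ R k) (if k = 0 then 0 else edgeFactor σ R (k + 1) t) t := by
  rcases eq_or_ne k 0 with rfl | h
  · have : edgeFactor σ R 0 = fun _ => 1 := by ext; simp [edgeFactor]
    simpa [this] using hasDerivAt_const t (1 : ℝ)
  · have h1 := hasDerivAt_bernsteinDeriv σ R k ht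
    unfold edgeFactor
    simpa [h] using h1

lemma integrable_prod_pow {E Ω : Type*} [Fintype E] [MeasurableSpace Ω] {μ : Measure Ω}
    {Y : E → Ω → ℝ} (hind : iIndepFun Y μ) (hmeas : ∀ e, Measurable (Y e))
    (hint : ∀ e k, Integrable (fun ω => Y e ω ^ k) μ) (k : E → ℕ) :
    Integrable (fun ω => ∏ e, Y e ω ^ k e) μ := by
  refine ⟨(Finset.measurable_fun_prod _ fun e _ => (hmeas e).pow_const _).aestronglyMeasurable, ?_⟩
  have hind' : iIndepFun (fun e ω => ‖Y e ω ^ k e‖ₑ) μ :=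
    hind.comp (fun e x => ‖x ^ k e‖ₑ) fun e => (measurable_id.pow_const _).enorm
  have h := lintegral_prod_eq_prod_lintegral_of_indepFun Finset.univ _ hind'
    fun e => ((hmeas e).pow_const _).enorm
  have h2 : ∀ ω, ‖∏ e, Y e ω ^ k e‖ₑ = ∏ e, ‖Y e ω ^ k e‖ₑ := fun ω => by
    simp only [enorm_eq_nnnorm, nnnorm_prod, ENNReal.ofNNReal_finsetProd]
  unfold HasFiniteIntegral
  simp only [h2, h]
  exact ENNReal.prod_lt_top fun e _ => (hint e (k e)).2

variable {E V : Type*} [Fintype E] [DecidableEq E]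

/-- The majorant of the exponential generating function of walk sums weighted by `∏ Y e ^ k e`. -/
def walkMajorant (σ R M : ℝ) (k : E → ℕ) (t : ℝ) : ℝ :=
  Real.exp (M * bernsteinDeriv σ R 0 t) * ∏ e, edgeFactor σ R (k e) t

lemma hasDerivAt_walkMajorant (σ R M : ℝ) (k : E → ℕ) {t : ℝ} (ht : R * t < 1) :
    HasDerivAt (walkMajorant σ R M k)
      (M * (bernsteinDeriv σ R 1 t * walkMajorant σ R M k t) +
        ∑ e, Real.exp (M * bernsteinDeriv σ R 0 t) *
          ((∏ e' ∈ Finset.univ.erase e, edgeFactor σ R (k e') t) *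
            (if k e = 0 then 0 else edgeFactor σ R (k e + 1) t))) t := by
  have h1 := ((hasDerivAt_bernsteinDeriv σ R 0 ht).const_mul M).exp
  have h2 := HasDerivAt.fun_finsetProd (u := (Finset.univ : Finset E))
    (fun e _ => hasDerivAt_edgeFactor σ R (k e) ht)
  have h3 := h1.fun_mul h2
  refine h3.congr_deriv ?_
  simp only [walkMajorant, zero_add, smul_eq_mul, Finset.mul_sum]
  ring

/-- Raising one exponent replaces one edge factor. A fresh edge (`k e = 0`) picks up `ψ'`, which the
derivative of `exp (M ψ)` pays for; an edge already used passes to the next derivative of `ψ`, which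
is the product rule applied to its own factor. Thus the sum over available edges compares termwise
with the derivative of the majorant. -/
lemma walkMajorant_update_le (σ R M : ℝ) (k : E → ℕ) (t : ℝ) (e : E) :
    walkMajorant σ R M (Function.update k e (k e + 1)) t =
      (if k e = 0 then bernsteinDeriv σ R 1 t * walkMajorant σ R M k t else 0) +
      Real.exp (M * bernsteinDeriv σ R 0 t) *
          ((∏ e' ∈ Finset.univ.erase e, edgeFactor σ R (k e') t) *
            (if k e = 0 then 0 else edgeFactor σ R (k e + 1) t)) := by
  have h1 : ∏ e', edgeFactor σ R (Function.update k e (k e + 1) e') t =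
      (∏ e' ∈ Finset.univ.erase e, edgeFactor σ R (k e') t) * edgeFactor σ R (k e + 1) t := by
    rw [← Finset.prod_erase_mul _ _ (Finset.mem_univ e), Function.update_self]
    congr 1
    refine Finset.prod_congr rfl fun e' he' => ?_
    rw [Function.update_of_ne (Finset.ne_of_mem_erase he')]
  have h2 : ∏ e', edgeFactor σ R (k e') t =
      (∏ e' ∈ Finset.univ.erase e, edgeFactor σ R (k e') t) * edgeFactor σ R (k e) t :=
    (Finset.prod_erase_mul _ _ (Finset.mem_univ e)).symm
  unfold walkMajorant
  rw [h1]
  split_ifs with h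
  · rw [h2, h]
    simp only [edgeFactor, if_true, zero_add, one_ne_zero, if_false]
    ring
  · rw [zero_add]

/-- Sum of the products of edge weights over the walks with `L` steps from `x`, where
`step x` lists the possible moves, each an edge label with a target. -/
def walkSum (step : V → Finset (E × V)) (init : V → ℝ) (y : E → ℝ) : ℕ → V → ℝ
  | 0, x => init x
  | L + 1, x => ∑ p ∈ step x, y p.1 * walkSum step init y L p.2

/-- Differentiation shifts the coefficients and lowers the truncation degree by one, which is what
allows induction on the walk length. -/
lemma hasDerivAt_taylorSum (a : ℕ → ℝ) (L : ℕ) (t : ℝ) :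
    HasDerivAt (fun t => ∑ l ∈ Finset.range (L + 1), t ^ l / l.factorial * a l)
      (∑ l ∈ Finset.range L, t ^ l / l.factorial * a (l + 1)) t := by
  have h : ∀ l ∈ Finset.range (L + 1),
      HasDerivAt (fun t : ℝ => t ^ l / l.factorial * a l)
        ((l : ℝ) * t ^ (l - 1) / l.factorial * a l) t := fun l _ =>
    ((hasDerivAt_pow l t).div_const _).mul_const _
  refine (HasDerivAt.fun_sum h).congr_deriv ?_
  rw [Finset.sum_range_succ']
  simp only [Nat.cast_zero, zero_mul, zero_div, add_zero, Nat.add_sub_cancel]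
  refine Finset.sum_congr rfl fun l _ => ?_
  rw [Nat.factorial_succ]
  push_cast
  field_simp

variable {Ω : Type*} [MeasurableSpace Ω] {μ : Measure Ω} {Y : E → Ω → ℝ}

lemma prod_pow_update (y : E → ℝ) (k : E → ℕ) (e : E) :
    ∏ e', y e' ^ Function.update k e (k e + 1) e' = (∏ e', y e' ^ k e') * y e := by
  rw [← Finset.prod_erase_mul _ _ (Finset.mem_univ e),
    ← Finset.prod_erase_mul (Finset.univ) (fun e' => y e' ^ k e') (Finset.mem_univ e),
    Function.update_self, pow_succ, mul_assoc]
  congr 1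
  refine Finset.prod_congr rfl fun e' he' => ?_
  rw [Function.update_of_ne (Finset.ne_of_mem_erase he')]

/-- The first step of the walk is absorbed into the exponents, so that the recursion closes on pairs
(exponents, current vertex) although walks may repeat edges. -/
lemma prod_pow_mul_walkSum_succ (step : V → Finset (E × V)) (init : V → ℝ) (y : E → ℝ)
    (k : E → ℕ) (L : ℕ) (x : V) :
    (∏ e, y e ^ k e) * walkSum step init y (L + 1) x =
      ∑ p ∈ step x, (∏ e, y e ^ Function.update k p.1 (k p.1 + 1) e) *
        walkSum step init y L p.2 := by
  rw [walkSum, Finset.mul_sum]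
  refine Finset.sum_congr rfl fun p _ => ?_
  rw [prod_pow_update, mul_assoc]

lemma integrable_prod_pow_mul_walkSum (hind : iIndepFun Y μ) (hmeas : ∀ e, Measurable (Y e))
    (hint : ∀ e k, Integrable (fun ω => Y e ω ^ k) μ) (step : V → Finset (E × V))
    (init : V → ℝ) (L : ℕ) (k : E → ℕ) (x : V) :
    Integrable (fun ω => (∏ e, Y e ω ^ k e) * walkSum step init (fun e => Y e ω) L x) μ := by
  induction L generalizing k x with
  | zero => exact (integrable_prod_pow hind hmeas hint k).mul_const _
  | succ L ih =>
    simp only [prod_pow_mul_walkSum_succ step init (fun e => Y e _)]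
    exact integrable_finsetSum _ fun p _ => ih _ _

/-- The Taylor sums of the generating function of expected walk sums are bounded by
`walkMajorant`. -/
lemma taylorSum_walk_le {σ R M : ℝ} (hR : 0 < R)
    (hind : iIndepFun Y μ) (hmeas : ∀ e, Measurable (Y e))
    (hint : ∀ e k, Integrable (fun ω => Y e ω ^ k) μ)
    (hmom : ∀ e k, 1 ≤ k → |∫ ω, Y e ω ^ k ∂μ| ≤ bernsteinDeriv σ R k 0)
    (step : V → Finset (E × V)) (hinj : ∀ x, Set.InjOn Prod.fst (step x : Set (E × V)))
    (hcard : ∀ x, ((step x).card : ℝ) ≤ M)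
    (init : V → ℝ) (hinit0 : ∀ x, 0 ≤ init x) (hinit1 : ∀ x, init x ≤ 1) (L : ℕ) (k : E → ℕ) (x : V)
    {t : ℝ} (ht0 : 0 ≤ t) (ht : R * t < 1) :
    ∑ l ∈ Finset.range (L + 1), t ^ l / l.factorial *
      ∫ ω, (∏ e, Y e ω ^ k e) * walkSum step init (fun e => Y e ω) l x ∂μ ≤
      walkMajorant σ R M k t := by
  set F : ℕ → (E → ℕ) → V → ℝ := fun l k x =>
    ∫ ω, (∏ e, Y e ω ^ k e) * walkSum step init (fun e => Y e ω) l x ∂μ with hF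
  have hFsucc : ∀ l k x, F (l + 1) k x =
      ∑ p ∈ step x, F l (Function.update k p.1 (k p.1 + 1)) p.2 := fun l k x => by
    simp only [hF, prod_pow_mul_walkSum_succ step init (fun e => Y e _)]
    exact integral_finsetSum _ fun p _ =>
      integrable_prod_pow_mul_walkSum hind hmeas hint step init l _ _
  have := hind.isProbabilityMeasure
  -- Length zero: independence factors the expectation into single-entry moments, each bounded by a
  -- derivative of `ψ` at `0`.
  have hF0 : ∀ k x, F 0 k x ≤ walkMajorant σ R M k 0 := fun k x => by
    have hind' : iIndepFun (fun e ω => Y e ω ^ k e) μ :=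
      hind.comp (fun e x => x ^ k e) fun e => measurable_id.pow_const _
    have h1 : F 0 k x = (∏ e, ∫ ω, Y e ω ^ k e ∂μ) * init x := by
      simp only [hF, walkSum]
      rw [integral_mul_const, hind'.integral_fun_prod_eq_prod_integral
        fun e => ((hmeas e).pow_const _).aestronglyMeasurable]
    have h2 : walkMajorant σ R M k 0 = ∏ e, edgeFactor σ R (k e) 0 := by
      simp [walkMajorant, bernsteinDeriv]
    rw [h1, h2]
    have h3 : |∏ e, ∫ ω, Y e ω ^ k e ∂μ| ≤ ∏ e, edgeFactor σ R (k e) 0 := by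
      rw [Finset.abs_prod]
      refine Finset.prod_le_prod (fun _ _ => abs_nonneg _) fun e _ => ?_
      unfold edgeFactor
      split_ifs with h
      · simp [h]
      · exact hmom e _ (by omega)
    calc _ ≤ |(∏ e, ∫ ω, Y e ω ^ k e ∂μ) * init x| := le_abs_self _
      _ ≤ |∏ e, ∫ ω, Y e ω ^ k e ∂μ| * 1 := by
        rw [abs_mul]
        refine mul_le_mul_of_nonneg_left ?_ (abs_nonneg _)
        rw [abs_of_nonneg (hinit0 x)]
        exact hinit1 x
      _ ≤ _ := by rwa [mul_one]
  change ∑ l ∈ Finset.range (L + 1), t ^ l / l.factorial * F l k x ≤ _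
  have hb : ∀ s ∈ Set.Ico (0 : ℝ) t, 0 ≤ s ∧ R * s < 1 := fun s hs =>
    ⟨hs.1, lt_of_le_of_lt (by nlinarith [hs.2]) ht⟩
  have hb' : ∀ s ∈ Set.Icc (0 : ℝ) t, 0 ≤ s ∧ R * s < 1 := fun s hs =>
    ⟨hs.1, lt_of_le_of_lt (by nlinarith [hs.2]) ht⟩
  clear_value F
  induction L generalizing k x t with
  | zero =>
    have hmono : walkMajorant σ R M k 0 ≤ walkMajorant σ R M k t := by
      have hM : 0 ≤ M := le_trans (Nat.cast_nonneg _) (hcard x)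
      have h : MonotoneOn (walkMajorant σ R M k) (Set.Icc 0 t) := by
        refine monotoneOn_of_deriv_nonneg (convex_Icc 0 t)
          (fun s hs => (hasDerivAt_walkMajorant σ R M k
            (hb' s hs).2).continuousAt.continuousWithinAt)
          (fun s hs => (hasDerivAt_walkMajorant σ R M k
            (hb' s (interior_subset hs)).2).differentiableAt.differentiableWithinAt)
          fun s hs => ?_
        obtain ⟨hs0, hs1⟩ := hb' s (interior_subset hs)
        have hef := fun k => edgeFactor_nonneg σ hR hs0 hs1 k
        rw [(hasDerivAt_walkMajorant σ R M k hs1).deriv]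
        refine add_nonneg (mul_nonneg hM (mul_nonneg
          (bernsteinDeriv_nonneg σ hR hs0 hs1 le_rfl)
          (mul_nonneg (Real.exp_nonneg _) (Finset.prod_nonneg fun e _ => hef _))))
          (Finset.sum_nonneg fun e _ => mul_nonneg (Real.exp_nonneg _)
            (mul_nonneg (Finset.prod_nonneg fun e _ => hef _) ?_))
        split_ifs
        · exact le_rfl
        · exact hef _
      exact h ⟨le_rfl, ht0⟩ ⟨ht0, le_rfl⟩ ht0
    simpa using (hF0 k x).trans hmono
  | succ L ih =>
    -- Comparison at `0` together with an inequality between derivatives. The derivative of the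
    -- Taylor sum is a sum of shorter Taylor sums with one exponent raised, to which the induction
    -- hypothesis applies.
    refine image_le_of_deriv_right_le_deriv_boundary
      (f := fun t => ∑ l ∈ Finset.range (L + 1 + 1), t ^ l / l.factorial * F l k x)
      (a := 0) (b := t) (B := walkMajorant σ R M k)
      (fun s _ => (hasDerivAt_taylorSum _ _ s).continuousAt.continuousWithinAt)
      (fun s _ => (hasDerivAt_taylorSum (fun l => F l k x) _ s).hasDerivWithinAt) ?_
      (fun s hs => (hasDerivAt_walkMajorant σ R M k (hb' s hs).2).continuousAt.continuousWithinAt)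
      (fun s hs => (hasDerivAt_walkMajorant σ R M k (hb s hs).2).hasDerivWithinAt)
      (fun s hs => ?_) ⟨ht0, le_rfl⟩
    · have : ∑ l ∈ Finset.range (L + 1 + 1), (0 : ℝ) ^ l / l.factorial * F l k x = F 0 k x := by
        rw [Finset.sum_range_succ']
        simp
      simpa only [this] using hF0 k x
    · obtain ⟨hs0, hs1⟩ := hb s hs
      have hef := fun k => edgeFactor_nonneg σ hR hs0 hs1 k
      have hW : 0 ≤ walkMajorant σ R M k s :=
        mul_nonneg (Real.exp_nonneg _) (Finset.prod_nonneg fun e _ => hef _)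
      have hg := bernsteinDeriv_nonneg σ hR hs0 hs1 (le_refl 1)
      simp only [hFsucc, Finset.mul_sum]
      rw [Finset.sum_comm]
      calc _ ≤ ∑ p ∈ step x, walkMajorant σ R M (Function.update k p.1 (k p.1 + 1)) s := by
            refine Finset.sum_le_sum fun p _ => ih _ _ hs0 hs1 ?_ ?_
            · exact fun u hu => hb u ⟨hu.1, hu.2.trans hs.2⟩
            · exact fun u hu => hb u ⟨hu.1, hu.2.trans_lt hs.2⟩
        _ ≤ _ := by
            simp only [walkMajorant_update_le]
            rw [Finset.sum_add_distrib]
            refine add_le_add ?_ ?_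
            · calc _ ≤ ∑ p ∈ step x, bernsteinDeriv σ R 1 s * walkMajorant σ R M k s := by
                    refine Finset.sum_le_sum fun p _ => ?_
                    split_ifs
                    · exact le_rfl
                    · exact mul_nonneg hg hW
                _ ≤ _ := by
                    rw [Finset.sum_const, nsmul_eq_mul]
                    exact mul_le_mul_of_nonneg_right (hcard x) (mul_nonneg hg hW)
            -- Moves from `x` carry distinct edge labels, so each used edge is counted at most once
            -- and the sum extends to all edges.
            · rw [← Finset.sum_image (f := fun e => Real.exp (M * bernsteinDeriv σ R 0 s) *
                ((∏ e' ∈ Finset.univ.erase e, edgeFactor σ R (k e') s) *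
                  (if k e = 0 then 0 else edgeFactor σ R (k e + 1) s))) (hinj x)]
              refine Finset.sum_le_univ_sum_of_nonneg fun e => mul_nonneg (Real.exp_nonneg _)
                (mul_nonneg (Finset.prod_nonneg fun e _ => hef _) ?_)
              split_ifs
              · exact le_rfl
              · exact hef _

end WalkMoments

/-! ### Bernstein tails -/

section Tails

lemma sum_range_two_mul (f : ℕ → ℝ) (P : ℕ) :
    ∑ l ∈ Finset.range (2 * P), f l = ∑ p ∈ Finset.range P, (f (2 * p) + f (2 * p + 1)) := by
  induction P with
  | zero => simp
  | succ P ih =>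
    rw [Finset.sum_range_succ, ← ih, Nat.mul_succ, Finset.sum_range_succ, Finset.sum_range_succ,
      add_assoc]

/-- With `q = σ √(2Mτ)` and deviation level `t = q + 2Rτ`, the witness `θ = 2τ / t` gives `1 - Rθ =
q / t`. Then `θ t = 2τ` while `M ψ(θ) = τ q / t ≤ τ`. -/
lemma exists_bernstein_parameter {σ R M τ : ℝ} (hσ : 0 < σ) (hR : 0 < R) (hM : 0 < M)
    (hτ : 0 < τ) : ∃ θ : ℝ, 0 ≤ θ ∧ R * θ < 1 ∧
      M * bernsteinDeriv σ R 0 θ - θ * (σ * Real.sqrt (2 * M * τ) + 2 * R * τ) ≤ -τ := by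
  set q := σ * Real.sqrt (2 * M * τ) with hq
  have hq0 : 0 < q := mul_pos hσ (Real.sqrt_pos.2 (by positivity))
  have hq2 : q ^ 2 = σ ^ 2 * (2 * M * τ) := by
    rw [hq, mul_pow, Real.sq_sqrt (by positivity)]
  have hd : 0 < q + 2 * R * τ := by positivity
  have h1 : 1 - R * (2 * τ / (q + 2 * R * τ)) = q / (q + 2 * R * τ) := by
    field_simp
    ring
  have h2 : R * (2 * τ / (q + 2 * R * τ)) < 1 := by
    have : 0 < q / (q + 2 * R * τ) := by positivity
    linarith
  refine ⟨2 * τ / (q + 2 * R * τ), by positivity, h2, ?_⟩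
  rw [bernsteinDeriv_zero hR.ne' h2, h1]
  have h3 : M * (σ ^ 2 * (2 * τ / (q + 2 * R * τ)) ^ 2 / (2 * (q / (q + 2 * R * τ)))) =
      τ * (q / (q + 2 * R * τ)) := by
    field_simp
    rw [hq2]
    ring
  have h4 : q / (q + 2 * R * τ) ≤ 1 := by
    rw [div_le_one hd]
    linarith [mul_pos hR hτ]
  have h5 : 2 * τ / (q + 2 * R * τ) * (q + 2 * R * τ) = 2 * τ := by field_simp
  rw [h3, h5]
  nlinarith

variable {Ω : Type*} [MeasurableSpace Ω] {μ : Measure Ω}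

/-- This is Markov's inequality for truncations of `cosh (θ Z)`, letting the truncation tend to
infinity. Only even moments are needed, and `cosh x ≥ e^x / 2` accounts for the factor `2`. -/
lemma measureReal_le_of_cosh_sum_le [IsProbabilityMeasure μ] {Z : Ω → ℝ} {W : ℕ → Ω → ℝ} {θ t C : ℝ} (hθ : 0 ≤ θ)
    (ht : 0 ≤ t) (hW : ∀ p, Integrable (W p) μ) (hZ : ∀ p ω, Z ω ^ (2 * p) ≤ W p ω)
    (hC : ∀ P, ∑ p ∈ Finset.range P, θ ^ (2 * p) / (2 * p).factorial * ∫ ω, W p ω ∂μ ≤ C) :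
    μ.real {ω | t ≤ |Z ω|} ≤ 2 * C * Real.exp (-(θ * t)) := by
  have hW0 : ∀ p ω, 0 ≤ W p ω := fun p ω =>
    le_trans (by rw [pow_mul]; positivity) (hZ p ω)
  have h1 : ∀ P, (∑ p ∈ Finset.range P, (θ * t) ^ (2 * p) / (2 * p).factorial) *
      μ.real {ω | t ≤ |Z ω|} ≤ C := fun P => by
    set f : Ω → ℝ := fun ω => ∑ p ∈ Finset.range P, θ ^ (2 * p) / (2 * p).factorial * W p ω
    have hf0 : 0 ≤ f := fun ω => Finset.sum_nonneg fun p _ => mul_nonneg (by positivity) (hW0 p ω)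
    have hf : Integrable f μ := integrable_finsetSum _ fun p _ => (hW p).const_mul _
    have hfC : ∫ ω, f ω ∂μ ≤ C := by
      rw [integral_finsetSum _ fun p _ => (hW p).const_mul _]
      simpa only [integral_const_mul] using hC P
    refine le_trans ?_ ((mul_meas_ge_le_integral_of_nonneg (ae_of_all _ hf0) hf
      (∑ p ∈ Finset.range P, (θ * t) ^ (2 * p) / (2 * p).factorial)).trans hfC)
    refine mul_le_mul_of_nonneg_left (measureReal_mono fun ω hω => ?_)
      (Finset.sum_nonneg fun p _ => by positivity)
    refine Finset.sum_le_sum (f := fun p => (θ * t) ^ (2 * p) / ((2 * p).factorial : ℝ))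
      (g := fun p => θ ^ (2 * p) / (2 * p).factorial * W p ω) fun p _ => ?_
    have h2 : t ^ (2 * p) ≤ W p ω := by
      refine le_trans ?_ (hZ p ω)
      rw [pow_mul, pow_mul, ← sq_abs (Z ω)]
      exact pow_le_pow_left₀ (by positivity) (pow_le_pow_left₀ ht hω 2) p
    simp only [mul_pow, mul_div_right_comm]
    exact mul_le_mul_of_nonneg_left h2 (by positivity)
  have h2 : Real.cosh (θ * t) * μ.real {ω | t ≤ |Z ω|} ≤ C :=
    le_of_tendsto ((Real.hasSum_cosh (θ * t)).tendsto_sum_nat.mul_const _)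
      (Filter.Eventually.of_forall h1)
  have h3 : Real.exp (θ * t) / 2 ≤ Real.cosh (θ * t) := by
    rw [Real.cosh_eq]
    linarith [Real.exp_pos (-(θ * t))]
  rw [Real.exp_neg, ← div_eq_mul_inv, le_div_iff₀ (Real.exp_pos _)]
  nlinarith [measureReal_nonneg (μ := μ) (s := {ω | t ≤ |Z ω|})]

variable {E : Type*} [Fintype E] [DecidableEq E] {Y : E → Ω → ℝ}

/-- A power of a sum is a walk sum on one vertex whose loops are labelled by `s`; the degree is then
the cardinality of `s`. -/
lemma taylorSum_sum_pow_le {σ R M : ℝ} (hR : 0 < R)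
    (hind : iIndepFun Y μ) (hmeas : ∀ e, Measurable (Y e))
    (hint : ∀ e k, Integrable (fun ω => Y e ω ^ k) μ)
    (hmom : ∀ e k, 1 ≤ k → |∫ ω, Y e ω ^ k ∂μ| ≤ bernsteinDeriv σ R k 0)
    (s : Finset E) (hs : (s.card : ℝ) ≤ M) {θ : ℝ} (hθ : 0 ≤ θ) (hRθ : R * θ < 1) :
    (∀ l, Integrable (fun ω => (∑ e ∈ s, Y e ω) ^ l) μ) ∧
    ∀ L, ∑ l ∈ Finset.range (L + 1), θ ^ l / l.factorial * ∫ ω, (∑ e ∈ s, Y e ω) ^ l ∂μ ≤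
      Real.exp (M * bernsteinDeriv σ R 0 θ) := by
  set step : Unit → Finset (E × Unit) := fun _ => s ×ˢ {()} with hstep
  have hwalk : ∀ l y, walkSum step (fun _ => 1) y l () = (∑ e ∈ s, y e) ^ l := fun l y => by
    induction l with
    | zero => simp [walkSum]
    | succ l ih =>
      rw [walkSum, Finset.sum_product, pow_succ', Finset.sum_mul]
      simp only [Finset.sum_singleton, ih]
  constructor
  · intro l
    have := integrable_prod_pow_mul_walkSum hind hmeas hint step (fun _ => 1) l 0 ()
    simpa [hwalk] using this
  · intro L
    have := taylorSum_walk_le (σ := σ) (M := M) hR hind hmeas hint hmom step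
      (fun x p _ q _ h => Prod.ext h rfl) (fun x => by simpa [hstep] using hs) (fun _ => 1)
      (fun _ => zero_le_one) (fun _ => le_rfl) L 0 () hθ hRθ
    simpa [hwalk, walkMajorant, edgeFactor] using this

/-- Bernstein's inequality for a sum over a finite set of independent variables. -/
lemma measureReal_abs_sum_ge_le {σ R M τ : ℝ} (hσ : 0 < σ) (hR : 0 < R) (hM : 0 < M) (hτ : 0 < τ)
    (hind : iIndepFun Y μ) (hmeas : ∀ e, Measurable (Y e))
    (hint : ∀ e k, Integrable (fun ω => Y e ω ^ k) μ)
    (hmom : ∀ e k, 1 ≤ k → |∫ ω, Y e ω ^ k ∂μ| ≤ bernsteinDeriv σ R k 0)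
    (s : Finset E) (hs : (s.card : ℝ) ≤ M) :
    μ.real {ω | σ * Real.sqrt (2 * M * τ) + 2 * R * τ ≤ |∑ e ∈ s, Y e ω|} ≤
      2 * Real.exp (-τ) := by
  have := hind.isProbabilityMeasure
  obtain ⟨θ, hθ, hRθ, hle⟩ := exists_bernstein_parameter hσ hR hM hτ
  obtain ⟨hI, h1⟩ := taylorSum_sum_pow_le hR hind hmeas hint hmom s hs hθ hRθ
  -- The same bound for `-Y`. Averaging it with the bound for `Y` cancels the odd moments, whose
  -- signs are unknown.
  obtain ⟨-, h2⟩ := taylorSum_sum_pow_le (Y := fun e ω => -Y e ω) hR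
    (hind.comp (fun _ x => -x) fun _ => measurable_neg) (fun e => (hmeas e).neg)
    (fun e k => by
      simp only [neg_pow (Y e _)]
      exact (hint e k).const_mul _)
    (fun e k hk => by
      simp only [neg_pow (Y e _), integral_const_mul, abs_mul, abs_pow, abs_neg, abs_one, one_pow,
        one_mul]
      exact hmom e k hk) s hs hθ hRθ
  have h3 := measureReal_le_of_cosh_sum_le (μ := μ) (Z := fun ω => ∑ e ∈ s, Y e ω)
    (W := fun p ω => (∑ e ∈ s, Y e ω) ^ (2 * p)) (C := Real.exp (M * bernsteinDeriv σ R 0 θ))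
    (t := σ * Real.sqrt (2 * M * τ) + 2 * R * τ) hθ (by positivity) (fun p => hI _)
    (fun p ω => le_rfl) fun P => by
      rcases P with _ | P
      · simpa using Real.exp_nonneg _
      have h1 := h1 (2 * P + 1)
      have h2 := h2 (2 * P + 1)
      rw [show 2 * P + 1 + 1 = 2 * (P + 1) by ring, sum_range_two_mul,
        Finset.sum_add_distrib] at h1 h2
      have hneg : ∀ l, ∫ ω, (∑ e ∈ s, -Y e ω) ^ l ∂μ =
          (-1) ^ l * ∫ ω, (∑ e ∈ s, Y e ω) ^ l ∂μ := fun l => by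
        simp only [Finset.sum_neg_distrib, neg_pow (∑ e ∈ s, Y e _), integral_const_mul]
      simp only [hneg] at h2
      simp only [pow_succ (-1 : ℝ), pow_mul (-1 : ℝ), pow_zero, one_mul, mul_neg, neg_neg,
        mul_one, one_pow, neg_mul, Finset.sum_neg_distrib] at h2
      linarith
  refine h3.trans ?_
  rw [mul_assoc, ← Real.exp_add]
  gcongr
  linarith

end Tails

/-! ### Spectral norm via closed walks on the bipartite graph. -/

section Spectral

open scoped Matrix.Norms.L2Operator in
-- The norm is the largest eigenvalue, and its power is one term of the trace, the other terms being
-- nonnegative.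
lemma norm_pow_le_trace_pow {ι : Type*} [Fintype ι] [DecidableEq ι] [Nonempty ι]
    {B : Matrix ι ι ℝ} (hB : B.PosSemidef) (p : ℕ) : ‖B‖ ^ p ≤ (B ^ p).trace := by
  have hH := hB.isHermitian
  set v := hH.eigenvalues with hv
  have hspec : B = Unitary.conjStarAlgAut ℝ _ hH.eigenvectorUnitary (Matrix.diagonal v) := by
    simpa using hH.spectral_theorem
  have hnorm : ‖B‖ = ‖v‖ := by
    rw [hspec, Unitary.conjStarAlgAut_apply, ← Unitary.coe_star,
      CStarRing.norm_mul_coe_unitary, CStarRing.norm_coe_unitary_mul, Matrix.l2_opNorm_diagonal]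
  have htrace : (B ^ p).trace = ∑ i, v i ^ p := by
    conv_lhs => rw [hspec]
    rw [← map_pow, Unitary.conjStarAlgAut_apply, Matrix.trace_mul_cycle, Unitary.coe_star_mul_self,
      one_mul, Matrix.diagonal_pow, Matrix.trace_diagonal]
    rfl
  have hv0 : ∀ i, 0 ≤ v i := hB.eigenvalues_nonneg
  obtain ⟨i, hi⟩ := Finite.exists_max v
  have hle : ‖v‖ ≤ v i := (pi_norm_le_iff_of_nonneg (hv0 i)).2 fun j => by
    rw [Real.norm_of_nonneg (hv0 j)]
    exact hi j
  rw [hnorm, htrace]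
  exact (pow_le_pow_left₀ (norm_nonneg _) hle p).trans
    (Finset.single_le_sum (f := fun i => v i ^ p) (fun j _ => pow_nonneg (hv0 j) p)
      (Finset.mem_univ i))

lemma spectralNorm_pow_le_trace_pow {m n : ℕ} (hm : 0 < m) (A : Matrix (Fin m) (Fin n) ℝ) (p : ℕ) :
    spectralNorm A ^ (2 * p) ≤ ((A * A.transpose) ^ p).trace := by
  have : Nonempty (Fin m) := ⟨⟨0, hm⟩⟩
  have h1 := norm_pow_le_trace_pow (Matrix.posSemidef_self_mul_conjTranspose A) p
  have h2 := Matrix.l2_opNorm_conjTranspose_mul_self A.conjTranspose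
  rw [Matrix.conjTranspose_conjTranspose, Matrix.l2_opNorm_conjTranspose, ← sq] at h2
  rw [h2, ← pow_mul, Matrix.conjTranspose_eq_transpose_of_trivial] at h1
  exact h1

/-- The moves on the bipartite graph with vertices the rows and the columns, whose edges are the
matrix entries. -/
def bipartiteStep (m n : ℕ) : Fin m ⊕ Fin n → Finset ((Fin m × Fin n) × (Fin m ⊕ Fin n))
  | .inl i => Finset.univ.image fun j => ((i, j), Sum.inr j)
  | .inr j => Finset.univ.image fun i => ((i, j), Sum.inl i)

variable {m n : ℕ}

lemma sum_bipartiteStep_inl (i : Fin m) (f : (Fin m × Fin n) × (Fin m ⊕ Fin n) → ℝ) :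
    ∑ p ∈ bipartiteStep m n (.inl i), f p = ∑ j, f ((i, j), .inr j) :=
  Finset.sum_image fun j _ j' _ h => by simpa using h

lemma sum_bipartiteStep_inr (j : Fin n) (f : (Fin m × Fin n) × (Fin m ⊕ Fin n) → ℝ) :
    ∑ p ∈ bipartiteStep m n (.inr j), f p = ∑ i, f ((i, j), .inl i) :=
  Finset.sum_image fun i _ i' _ h => by simpa using h

lemma injOn_fst_bipartiteStep (x : Fin m ⊕ Fin n) :
    Set.InjOn Prod.fst (bipartiteStep m n x : Set ((Fin m × Fin n) × (Fin m ⊕ Fin n))) := by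
  rcases x with i | j <;>
  · simp only [bipartiteStep, Finset.coe_image, Finset.coe_univ, Set.image_univ]
    rintro _ ⟨a, rfl⟩ _ ⟨b, rfl⟩ h
    simp only [Prod.mk.injEq, true_and, and_true] at h
    rw [h]

lemma card_bipartiteStep_le (x : Fin m ⊕ Fin n) :
    ((bipartiteStep m n x).card : ℝ) ≤ maxDim m n := by
  rcases x with i | j
  · refine le_trans ?_ (le_max_right _ _)
    exact_mod_cast Finset.card_image_le.trans (by simp)
  · refine le_trans ?_ (le_max_left _ _)
    exact_mod_cast Finset.card_image_le.trans (by simp)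

/-- Two steps of the walk, row to column to row, are one multiplication by `Y Yᵀ`. The two vanishing
clauses express parity and are needed to carry the induction; the last one also removes odd lengths
from the generating function. -/
lemma walkSum_bipartite (y : Fin m × Fin n → ℝ) (z : Fin m) (p : ℕ) :
    (∀ i, walkSum (bipartiteStep m n) (Pi.single (.inl z) 1) y (2 * p) (.inl i) =
      ((Matrix.of (fun i j => y (i, j)) * (Matrix.of (fun i j => y (i, j))).transpose) ^ p) i z) ∧
    (∀ j, walkSum (bipartiteStep m n) (Pi.single (.inl z) 1) y (2 * p) (.inr j) = 0) ∧
    (∀ i, walkSum (bipartiteStep m n) (Pi.single (.inl z) 1) y (2 * p + 1) (.inl i) = 0) := by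
  induction p with
  | zero =>
    refine ⟨fun i => ?_, fun j => ?_, fun i => ?_⟩
    · simp [walkSum, Matrix.one_apply, Pi.single_apply]
    · simp [walkSum]
    · simp [walkSum, sum_bipartiteStep_inl]
  | succ p ih =>
    obtain ⟨h1, h2, h3⟩ := ih
    have h4 : ∀ j, walkSum (bipartiteStep m n) (Pi.single (.inl z) 1) y (2 * (p + 1)) (.inr j) = 0 :=
      fun j => by
        rw [Nat.mul_succ, walkSum, sum_bipartiteStep_inr]
        exact Finset.sum_eq_zero fun i _ => by rw [h3, mul_zero]
    refine ⟨fun i => ?_, h4, fun i => ?_⟩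
    · rw [Nat.mul_succ, walkSum, sum_bipartiteStep_inl, pow_succ', Matrix.mul_assoc,
        Matrix.mul_apply]
      refine Finset.sum_congr rfl fun j _ => ?_
      rw [walkSum, sum_bipartiteStep_inr, Matrix.mul_apply]
      simp only [h1]
      rfl
    · rw [walkSum, sum_bipartiteStep_inl]
      exact Finset.sum_eq_zero fun j _ => by rw [h4, mul_zero]

variable {Ω : Type*} [MeasurableSpace Ω] {μ : Measure Ω} {Y : Fin m × Fin n → Ω → ℝ}

/-- Matrix Bernstein inequality for the spectral norm of a matrix with independent entries. -/
lemma measureReal_spectralNorm_ge_le {σ R τ : ℝ} (hσ : 0 < σ) (hR : 0 < R) (hm : 0 < m)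
    (hτ : 0 < τ) (hind : iIndepFun Y μ) (hmeas : ∀ e, Measurable (Y e))
    (hint : ∀ e k, Integrable (fun ω => Y e ω ^ k) μ)
    (hmom : ∀ e k, 1 ≤ k → |∫ ω, Y e ω ^ k ∂μ| ≤ bernsteinDeriv σ R k 0) :
    μ.real {ω | σ * Real.sqrt (2 * maxDim m n * τ) + 2 * R * τ ≤
      spectralNorm (Matrix.of fun i j => Y (i, j) ω)} ≤ 2 * m * Real.exp (-τ) := by
  have := hind.isProbabilityMeasure
  have hM : 0 < maxDim m n := lt_of_lt_of_le (Nat.cast_pos.2 hm) (le_max_left _ _)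
  obtain ⟨θ, hθ, hRθ, hle⟩ := exists_bernstein_parameter hσ hR hM hτ
  set B : Ω → Matrix (Fin m) (Fin m) ℝ := fun ω =>
    Matrix.of (fun i j => Y (i, j) ω) * (Matrix.of (fun i j => Y (i, j) ω)).transpose with hB
  have hI : ∀ p i, Integrable (fun ω => (B ω ^ p) i i) μ := fun p i => by
    have := integrable_prod_pow_mul_walkSum hind hmeas hint (bipartiteStep m n)
      (Pi.single (.inl i) 1) (2 * p) 0 (.inl i)
    simpa [(walkSum_bipartite (fun e => Y e _) i p).1 i] using this
  have hsum : ∀ P i, ∑ p ∈ Finset.range P, θ ^ (2 * p) / (2 * p).factorial *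
      ∫ ω, (B ω ^ p) i i ∂μ ≤ Real.exp (maxDim m n * bernsteinDeriv σ R 0 θ) := fun P i => by
    rcases P with _ | P
    · simpa using Real.exp_nonneg _
    have h := taylorSum_walk_le (σ := σ) (M := maxDim m n) hR hind hmeas hint hmom
      (bipartiteStep m n) injOn_fst_bipartiteStep card_bipartiteStep_le (Pi.single (.inl i) 1)
      (fun x => by rw [Pi.single_apply]; split_ifs <;> norm_num)
      (fun x => by rw [Pi.single_apply]; split_ifs <;> norm_num) (2 * P + 1) 0 (.inl i) hθ hRθ
    rw [show 2 * P + 1 + 1 = 2 * (P + 1) by ring, sum_range_two_mul] at h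
    simpa [(walkSum_bipartite (fun e => Y e _) i _).1 i,
      (walkSum_bipartite (fun e => Y e _) i _).2.2 i, walkMajorant, edgeFactor] using h
  have h3 := measureReal_le_of_cosh_sum_le (μ := μ)
    (Z := fun ω => spectralNorm (Matrix.of fun i j => Y (i, j) ω))
    (W := fun p ω => (B ω ^ p).trace) (C := m * Real.exp (maxDim m n * bernsteinDeriv σ R 0 θ))
    (t := σ * Real.sqrt (2 * maxDim m n * τ) + 2 * R * τ) hθ (by positivity)
    (fun p => integrable_finsetSum _ fun i _ => hI p i)
    (fun p ω => spectralNorm_pow_le_trace_pow hm _ p) fun P => by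
      have h1 : ∀ p, ∫ ω, (B ω ^ p).trace ∂μ = ∑ i, ∫ ω, (B ω ^ p) i i ∂μ := fun p =>
        integral_finsetSum _ fun i _ => hI p i
      simp only [h1, Finset.mul_sum]
      rw [Finset.sum_comm]
      refine (Finset.sum_le_sum fun i _ => hsum P i).trans ?_
      simp
  refine (measureReal_mono fun ω hω => ?_).trans (h3.trans ?_)
  · rw [Set.mem_ofPred_eq] at hω ⊢
    exact hω.trans (le_abs_self _)
  · rw [← mul_assoc 2, mul_assoc (2 * (m : ℝ)), ← Real.exp_add]
    refine mul_le_mul_of_nonneg_left (Real.exp_le_exp.2 ?_) (by positivity)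
    linarith

end Spectral

/-! ### Lower tails for sums of nonnegative variables. -/

section LowerTail

variable {Ω : Type*} [MeasurableSpace Ω] {μ : Measure Ω}

lemma exp_neg_le_one_sub_add_sq {x : ℝ} (hx : 0 ≤ x) : Real.exp (-x) ≤ 1 - x + x ^ 2 / 2 := by
  have h : AntitoneOn (fun x : ℝ => Real.exp (-x) - (1 - x + x ^ 2 / 2)) (Set.Ici 0) := by
    have hd : ∀ x : ℝ, HasDerivAt (fun x : ℝ => Real.exp (-x) - (1 - x + x ^ 2 / 2))
        (-Real.exp (-x) + 1 - x) x := fun x => by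
      have h1 := (hasDerivAt_neg x).exp
      have h2 := (((hasDerivAt_id x).const_sub 1).add (((hasDerivAt_id x).pow 2).div_const 2))
      refine (h1.sub h2).congr_deriv ?_
      simp
      ring
    refine antitoneOn_of_deriv_nonpos (convex_Ici 0)
      (fun x _ => (hd x).continuousAt.continuousWithinAt)
      (fun x _ => (hd x).differentiableAt.differentiableWithinAt) fun x _ => ?_
    rw [(hd x).deriv]
    linarith [Real.add_one_le_exp (-x)]
  have := h (Set.mem_Ici.2 le_rfl) (Set.mem_Ici.2 hx) hx
  simp at this
  linarith

/-- Lower tail bound for a sum of independent nonnegative variables with second moment at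
most `s`. -/
lemma measureReal_sum_le_le {J : Type*} [Fintype J] [IsProbabilityMeasure μ] {Z : J → Ω → ℝ}
    (hind : ∀ (s : Finset J) (j : J), j ∉ s → IndepFun (∑ i ∈ s, Z i) (Z j) μ)
    (hmeas : ∀ j, Measurable (Z j)) (h0 : ∀ j, 0 ≤ᵐ[μ] Z j) (hint : ∀ j, Integrable (Z j) μ)
    (hint2 : ∀ j, Integrable (fun ω => Z j ω ^ 2) μ) {a s : ℝ} (ha : 0 < a) (hs : 0 < s)
    (hmean : ∀ j, a ≤ ∫ ω, Z j ω ∂μ) (hsq : ∀ j, ∫ ω, Z j ω ^ 2 ∂μ ≤ s) :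
    μ.real {ω | ∑ j, Z j ω ≤ Fintype.card J * a / 2} ≤
      Real.exp (-(Fintype.card J * (a ^ 2 / (8 * s)))) := by
  have hsum : ∀ s : Finset J, Measurable (∑ j ∈ s, Z j) := fun s => by
    rw [show ∑ j ∈ s, Z j = fun ω => ∑ j ∈ s, Z j ω by ext; simp]
    exact Finset.measurable_sum s fun j _ => hmeas j
  -- This minimizes the exponent per summand, `-l a / 2 + l² s / 2`, with minimum `-a² / (8 s)`.
  set l : ℝ := a / (2 * s) with hl
  have hl0 : 0 < l := by positivity
  have hmgf : ∀ j, mgf (Z j) μ (-l) ≤ Real.exp (-l * a + l ^ 2 * s / 2) := fun j => by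
    have h1 : mgf (Z j) μ (-l) ≤ ∫ ω, (1 - l * Z j ω + l ^ 2 / 2 * Z j ω ^ 2) ∂μ := by
      refine integral_mono_of_nonneg (ae_of_all _ fun _ => Real.exp_nonneg _)
        (((integrable_const _).sub ((hint j).const_mul _)).add ((hint2 j).const_mul _)) ?_
      filter_upwards [h0 j] with ω hω
      have := exp_neg_le_one_sub_add_sq (mul_nonneg hl0.le hω)
      simp only [neg_mul]
      linarith
    have hI1 : Integrable (fun ω => 1 - l * Z j ω) μ :=
      (integrable_const _).sub ((hint j).const_mul _)
    have h2 : ∫ ω, (1 - l * Z j ω + l ^ 2 / 2 * Z j ω ^ 2) ∂μ =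
        1 - l * ∫ ω, Z j ω ∂μ + l ^ 2 / 2 * ∫ ω, Z j ω ^ 2 ∂μ := by
      rw [integral_add hI1 ((hint2 j).const_mul _),
        integral_sub (integrable_const _) ((hint j).const_mul _), integral_const_mul,
        integral_const_mul]
      simp
    have h3 : l * a ≤ l * ∫ ω, Z j ω ∂μ := mul_le_mul_of_nonneg_left (hmean j) hl0.le
    have h4 : l ^ 2 / 2 * ∫ ω, Z j ω ^ 2 ∂μ ≤ l ^ 2 / 2 * s :=
      mul_le_mul_of_nonneg_left (hsq j) (by positivity)
    have h5 := Real.add_one_le_exp (-l * a + l ^ 2 * s / 2)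
    linarith
  have hI : Integrable (fun ω => Real.exp (-l * (∑ j, Z j) ω)) μ := by
    refine Integrable.of_bound (C := 1)
      (Real.measurable_exp.comp ((hsum Finset.univ).const_mul (-l))).aestronglyMeasurable ?_
    filter_upwards [ae_all_iff.2 h0] with ω hω
    rw [Real.norm_of_nonneg (Real.exp_nonneg _), Real.exp_le_one_iff, Finset.sum_apply]
    have : 0 ≤ l * ∑ j, Z j ω := mul_nonneg hl0.le (Finset.sum_nonneg fun j _ => hω j)
    linarith
  have h := measure_le_le_exp_mul_mgf (X := ∑ j, Z j) (μ := μ) (Fintype.card J * a / 2)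
    (neg_nonpos.2 hl0.le) hI
  have hmgf_sum : ∀ s : Finset J, mgf (∑ j ∈ s, Z j) μ (-l) = ∏ j ∈ s, mgf (Z j) μ (-l) := by
    classical
    intro s
    induction s using Finset.induction_on with
    | empty => simp
    | insert j s hj ih =>
      rw [Finset.sum_insert hj, Finset.prod_insert hj, ← ih]
      refine (hind s j hj).symm.mgf_add' (hmeas j).aestronglyMeasurable
        (hsum s).aestronglyMeasurable
  rw [hmgf_sum] at h
  simp only [Finset.sum_apply] at h
  refine h.trans ?_
  have hprod : ∏ j, mgf (Z j) μ (-l) ≤ Real.exp (Fintype.card J * (-l * a + l ^ 2 * s / 2)) := by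
    refine (Finset.prod_le_prod (fun _ _ => mgf_nonneg) fun j _ => hmgf j).trans ?_
    rw [Finset.prod_const, ← Real.exp_nat_mul, Finset.card_univ]
  refine (mul_le_mul_of_nonneg_left hprod (Real.exp_nonneg _)).trans ?_
  rw [← Real.exp_add, Real.exp_le_exp, hl]
  apply le_of_eq
  field_simp
  ring

end LowerTail

/-! ### Moments of the entries and alignment of rows. -/

section Entries

variable {Ω : Type*} [MeasurableSpace Ω] {μ : Measure Ω} {m n : ℕ}
  {X : Ω → Matrix (Fin m) (Fin n) ℝ} {Λ : Matrix (Fin m) (Fin n) ℝ} {σ R : ℝ}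

lemma entryMin_le (Λ : Matrix (Fin m) (Fin n) ℝ) (i : Fin m) (j : Fin n) : entryMin Λ ≤ Λ i j :=
  ciInf_le (Set.finite_range fun p : Fin m × Fin n => Λ p.1 p.2).bddBelow (i, j)

lemma le_entryMax (Λ : Matrix (Fin m) (Fin n) ℝ) (i : Fin m) (j : Fin n) : Λ i j ≤ entryMax Λ :=
  le_ciSup (Set.finite_range fun p : Fin m × Fin n => Λ p.1 p.2).bddAbove (i, j)

lemma entryMin_pos (hm : 0 < m) (hn : 0 < n) (hΛ : ∀ i j, 0 < Λ i j) : 0 < entryMin Λ := by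
  have : Nonempty (Fin m × Fin n) := ⟨⟨0, hm⟩, ⟨0, hn⟩⟩
  obtain ⟨p, hp⟩ := exists_eq_ciInf_of_finite (f := fun p : Fin m × Fin n => Λ p.1 p.2)
  rw [entryMin, ← hp]
  exact hΛ _ _

/-- The weighted centred entries. -/
def centredEntry (X : Ω → Matrix (Fin m) (Fin n) ℝ) (Λ w : Matrix (Fin m) (Fin n) ℝ)
    (e : Fin m × Fin n) (ω : Ω) : ℝ := w e.1 e.2 * (X ω e.1 e.2 - Λ e.1 e.2)

lemma measurable_centredEntry (hX : IsSubexponential μ X Λ σ R) (w : Matrix (Fin m) (Fin n) ℝ)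
    (e : Fin m × Fin n) : Measurable (centredEntry X Λ w e) :=
  ((hX.measurable e.1 e.2).sub_const _).const_mul _

lemma iIndepFun_centredEntry (hX : IsSubexponential μ X Λ σ R) (w : Matrix (Fin m) (Fin n) ℝ) :
    iIndepFun (centredEntry X Λ w) μ :=
  hX.indep.comp (fun e x => w e.1 e.2 * (x - Λ e.1 e.2)) fun _ =>
    (measurable_id.sub_const _).const_mul _

lemma integrable_centredEntry_pow (hX : IsSubexponential μ X Λ σ R) (w : Matrix (Fin m) (Fin n) ℝ)
    (e : Fin m × Fin n) (k : ℕ) : Integrable (fun ω => centredEntry X Λ w e ω ^ k) μ := by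
  have := hX.indep.isProbabilityMeasure
  simp only [centredEntry, mul_pow]
  refine Integrable.const_mul ?_ _
  match k with
  | 0 => simp
  | 1 =>
    simp only [pow_one]
    exact (hX.integrable e.1 e.2).sub (integrable_const _)
  | k + 2 =>
    refine (hX.moment_integrable e.1 e.2 (k + 2) (by omega)).mono
      (((hX.measurable e.1 e.2).sub_const _).pow_const _).aestronglyMeasurable
      (ae_of_all _ fun ω => ?_)
    simp

/-- Weights of absolute value at most one cannot increase absolute moments, so weighted sums obey
the same Bernstein bound as unweighted ones. -/
lemma abs_integral_centredEntry_pow_le (hX : IsSubexponential μ X Λ σ R)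
    {w : Matrix (Fin m) (Fin n) ℝ} (hw : ∀ i j, |w i j| ≤ 1) (e : Fin m × Fin n) (k : ℕ)
    (hk : 1 ≤ k) : |∫ ω, centredEntry X Λ w e ω ^ k ∂μ| ≤ bernsteinDeriv σ R k 0 := by
  have := hX.indep.isProbabilityMeasure
  rcases hk.eq_or_lt with rfl | hk
  · simp only [centredEntry, pow_one, integral_const_mul]
    rw [integral_sub (hX.integrable e.1 e.2) (integrable_const _), hX.mean]
    simp [bernsteinDeriv_at_zero_one]
  · rw [bernsteinDeriv_at_zero hX.R_pos.ne' hk]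
    refine (abs_integral_le_integral_abs).trans (le_trans ?_ (hX.moment_le e.1 e.2 k hk))
    refine integral_mono_of_nonneg (ae_of_all _ fun _ => abs_nonneg _)
      (hX.moment_integrable e.1 e.2 k hk) (ae_of_all _ fun ω => ?_)
    simp only [centredEntry, abs_pow, abs_mul]
    exact pow_le_pow_left₀ (by positivity) (mul_le_of_le_one_left (abs_nonneg _) (hw _ _)) k

lemma integrable_entry_sq (hX : IsSubexponential μ X Λ σ R) (i : Fin m) (j : Fin n) :
    Integrable (fun ω => X ω i j ^ 2) μ := by
  have := hX.indep.isProbabilityMeasure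
  have h : ∀ ω, X ω i j ^ 2 = |X ω i j - Λ i j| ^ 2 + 2 * Λ i j * X ω i j - Λ i j ^ 2 := fun ω => by
    rw [sq_abs]
    ring
  simp only [h]
  exact ((hX.moment_integrable i j 2 le_rfl).add ((hX.integrable i j).const_mul _)).sub
    (integrable_const _)

lemma integral_entry_sq_le (hX : IsSubexponential μ X Λ σ R) (i : Fin m) (j : Fin n) :
    ∫ ω, X ω i j ^ 2 ∂μ ≤ (σ + R + entryMax Λ) ^ 2 := by
  have := hX.indep.isProbabilityMeasure
  have h : ∀ ω, X ω i j ^ 2 = |X ω i j - Λ i j| ^ 2 + 2 * Λ i j * X ω i j - Λ i j ^ 2 := fun ω => by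
    rw [sq_abs]
    ring
  have h1 : ∫ ω, |X ω i j - Λ i j| ^ 2 ∂μ ≤ σ ^ 2 :=
    (hX.moment_le i j 2 le_rfl).trans_eq (by norm_num)
  have hI : Integrable (fun ω => |X ω i j - Λ i j| ^ 2 + 2 * Λ i j * X ω i j) μ :=
    (hX.moment_integrable i j 2 le_rfl).add ((hX.integrable i j).const_mul _)
  simp only [h]
  rw [integral_sub hI (integrable_const _), integral_add (hX.moment_integrable i j 2 le_rfl)
    ((hX.integrable i j).const_mul _), integral_const_mul, hX.mean]
  simp only [integral_const, probReal_univ, one_smul]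
  have hm := le_entryMax Λ i j
  have hΛ := hX.mean_pos i j
  have hσ := hX.sigma_pos
  have hR := hX.R_pos
  nlinarith [mul_pos hσ hR, mul_pos hσ hΛ, mul_pos hR hΛ, sq_nonneg R]

/-- Two distinct rows of `X` have a large inner product with high probability. -/
lemma measureReal_row_inner_le (hX : IsSubexponential μ X Λ σ R) (hn : 0 < n) {i k : Fin m}
    (hik : i ≠ k) :
    μ.real {ω | ∑ j, X ω i j * X ω k j ≤ n * entryMin Λ ^ 2 / 2} ≤
      Real.exp (-(1 / 8) * alignRate Λ σ R) := by
  have := hX.indep.isProbabilityMeasure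
  have hm : 0 < m := i.pos
  have hmin : 0 < entryMin Λ := entryMin_pos hm hn hX.mean_pos
  have hs : 0 < σ + R + entryMax Λ := by
    have := hX.mean_pos i ⟨0, hn⟩
    linarith [le_entryMax Λ i ⟨0, hn⟩, hX.sigma_pos, hX.R_pos]
  have hpair : ∀ j, IndepFun (fun ω => X ω i j) (fun ω => X ω k j) μ := fun j =>
    hX.indep.indepFun (i := (i, j)) (j := (k, j)) (by simp [hik])
  have hpair2 : ∀ j, IndepFun (fun ω => X ω i j ^ 2) (fun ω => X ω k j ^ 2) μ := fun j =>
    (hpair j).comp (measurable_id.pow_const 2) (measurable_id.pow_const 2)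
  -- Products belonging to different columns use disjoint blocks of entries.
  have hind : ∀ (s : Finset (Fin n)) (j : Fin n), j ∉ s →
      IndepFun (∑ l ∈ s, fun ω => X ω i l * X ω k l) (fun ω => X ω i j * X ω k j) μ :=
    fun s j hj => by
      have h1 := hX.indep.indepFun_finset ({i, k} ×ˢ s) ({i, k} ×ˢ {j})
        (Finset.disjoint_product.2 (.inr (by simpa using hj))) fun p => hX.measurable p.1 p.2
      have hi : i ∈ ({i, k} : Finset (Fin m)) := by simp
      have hk : k ∈ ({i, k} : Finset (Fin m)) := by simp
      have hij := Finset.mk_mem_product hi (Finset.mem_singleton_self j)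
      have hkj := Finset.mk_mem_product hk (Finset.mem_singleton_self j)
      have hφ : Measurable fun f : ↥(({i, k} : Finset (Fin m)) ×ˢ s) → ℝ =>
          ∑ l : s, f ⟨(i, l.1), Finset.mk_mem_product hi l.2⟩ *
            f ⟨(k, l.1), Finset.mk_mem_product hk l.2⟩ := by fun_prop
      have hψ : Measurable fun f : ↥(({i, k} : Finset (Fin m)) ×ˢ ({j} : Finset (Fin n))) → ℝ =>
          f ⟨(i, j), hij⟩ * f ⟨(k, j), hkj⟩ := by fun_prop
      have h2 := h1.comp hφ hψ
      convert h2 using 1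
      · ext ω
        simp only [Finset.sum_apply, Function.comp]
        exact (Finset.sum_coe_sort s fun l => X ω i l * X ω k l).symm
      · rfl
  have h := measureReal_sum_le_le (a := entryMin Λ ^ 2) (s := (σ + R + entryMax Λ) ^ 4) hind
    (fun j => (hX.measurable i j).mul (hX.measurable k j))
    (fun j => by
      filter_upwards [hX.nonneg] with ω hω
      exact mul_nonneg (hω i j) (hω k j))
    (fun j => (hpair j).integrable_mul (hX.integrable i j) (hX.integrable k j))
    (fun j => by
      simp only [mul_pow]
      exact (hpair2 j).integrable_mul (integrable_entry_sq hX i j) (integrable_entry_sq hX k j))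
    (by positivity) (by positivity)
    (fun j => by
      rw [(hpair j).integral_fun_mul_eq_mul_integral
        (hX.measurable i j).aestronglyMeasurable (hX.measurable k j).aestronglyMeasurable,
        hX.mean, hX.mean, sq]
      exact mul_le_mul (entryMin_le Λ i j) (entryMin_le Λ k j) hmin.le (hX.mean_pos i j).le)
    (fun j => by
      simp only [mul_pow]
      rw [(hpair2 j).integral_fun_mul_eq_mul_integral
        ((hX.measurable i j).pow_const 2).aestronglyMeasurable
        ((hX.measurable k j).pow_const 2).aestronglyMeasurable]
      calc _ ≤ (σ + R + entryMax Λ) ^ 2 * (σ + R + entryMax Λ) ^ 2 :=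
            mul_le_mul (integral_entry_sq_le hX i j) (integral_entry_sq_le hX k j)
              (integral_nonneg fun _ => sq_nonneg _) (sq_nonneg _)
        _ = _ := by ring)
  rw [Fintype.card_fin] at h
  refine h.trans (Real.exp_le_exp.2 ?_)
  -- The tail obtained has rate one eighth of the first term of the minimum, which dominates the
  -- minimum.
  have h1 : alignRate Λ σ R ≤ n * (entryMin Λ ^ 4 / (σ + R + entryMax Λ) ^ 4) := min_le_left _ _
  have h2 : n * ((entryMin Λ ^ 2) ^ 2 / (8 * (σ + R + entryMax Λ) ^ 4)) =
      1 / 8 * (n * (entryMin Λ ^ 4 / (σ + R + entryMax Λ) ^ 4)) := by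
    field_simp
  rw [h2]
  linarith

end Entries

/-! ### The Sinkhorn map and its contraction -/

section Sinkhorn

variable {m n : ℕ}

lemma rescale_apply (α : Fin m → ℝ) (A : Matrix (Fin m) (Fin n) ℝ) (β : Fin n → ℝ) (i : Fin m)
    (j : Fin n) : rescale α A β i j = Real.exp (α i) * A i j * Real.exp (β j) := by
  simp [rescale, Matrix.mul_diagonal, Matrix.diagonal_mul]

/-- Column sums of `D(e^a) A`. -/
def colWeight (A : Matrix (Fin m) (Fin n) ℝ) (a : Fin m → ℝ) (j : Fin n) : ℝ :=
  ∑ k, A k j * Real.exp (a k)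

/-- Column scalings that give `D(e^a) A` the column sums `c`. -/
def colScale (A : Matrix (Fin m) (Fin n) ℝ) (c : Fin n → ℝ) (a : Fin m → ℝ) (j : Fin n) : ℝ :=
  c j / colWeight A a j

/-- Row sums of `A` after the column scaling. -/
def rowWeight (A : Matrix (Fin m) (Fin n) ℝ) (c : Fin n → ℝ) (a : Fin m → ℝ) (i : Fin m) : ℝ :=
  ∑ j, A i j * colScale A c a j

/-- One full Sinkhorn step on the row potentials. -/
def sinkhornMap (A : Matrix (Fin m) (Fin n) ℝ) (r : Fin m → ℝ) (c : Fin n → ℝ) (a : Fin m → ℝ)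
    (i : Fin m) : ℝ :=
  Real.log (r i) - Real.log (rowWeight A c a i)

/-- The Jacobian of the Sinkhorn map, a stochastic matrix. -/
def sinkhornKernel (A : Matrix (Fin m) (Fin n) ℝ) (c : Fin n → ℝ) (a : Fin m → ℝ)
    (i k : Fin m) : ℝ :=
  ∑ j, (A i j * colScale A c a j / rowWeight A c a i) *
    (A k j * Real.exp (a k) / colWeight A a j)

/-- A nonnegative matrix without zero rows or columns, with positive margins to be attained. -/
structure SinkhornData (A : Matrix (Fin m) (Fin n) ℝ) (r : Fin m → ℝ) (c : Fin n → ℝ) : Prop where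
  nonneg : ∀ i j, 0 ≤ A i j
  row : ∀ i, ∃ j, 0 < A i j
  col : ∀ j, ∃ i, 0 < A i j
  row_pos : ∀ i, 0 < r i
  col_pos : ∀ j, 0 < c j

variable {A : Matrix (Fin m) (Fin n) ℝ} {r : Fin m → ℝ} {c : Fin n → ℝ}

namespace SinkhornData

lemma colWeight_pos (h : SinkhornData A r c) (a : Fin m → ℝ) (j : Fin n) : 0 < colWeight A a j := by
  obtain ⟨i, hi⟩ := h.col j
  exact Finset.sum_pos' (fun k _ => mul_nonneg (h.nonneg k j) (Real.exp_nonneg _))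
    ⟨i, Finset.mem_univ i, mul_pos hi (Real.exp_pos _)⟩

lemma colScale_pos (h : SinkhornData A r c) (a : Fin m → ℝ) (j : Fin n) : 0 < colScale A c a j :=
  div_pos (h.col_pos j) (h.colWeight_pos a j)

lemma rowWeight_pos (h : SinkhornData A r c) (a : Fin m → ℝ) (i : Fin m) : 0 < rowWeight A c a i := by
  obtain ⟨j, hj⟩ := h.row i
  exact Finset.sum_pos' (fun k _ => mul_nonneg (h.nonneg i k) (h.colScale_pos a k).le)
    ⟨j, Finset.mem_univ j, mul_pos hj (h.colScale_pos a j)⟩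

/-- The infinitesimal form of the fact that the Sinkhorn map commutes with adding a constant to `a`.
-/
lemma sum_sinkhornKernel (h : SinkhornData A r c) (a : Fin m → ℝ) (i : Fin m) :
    ∑ k, sinkhornKernel A c a i k = 1 := by
  unfold sinkhornKernel
  rw [Finset.sum_comm]
  simp only [← Finset.mul_sum, ← Finset.sum_div]
  have h1 : ∀ j, (∑ k, A k j * Real.exp (a k)) / colWeight A a j = 1 := fun j =>
    div_self (h.colWeight_pos a j).ne'
  simp only [h1, mul_one, ← Finset.sum_div]
  exact div_self (h.rowWeight_pos a i).ne'

lemma hasDerivAt_sinkhornMap (h : SinkhornData A r c) (a d : Fin m → ℝ) (i : Fin m) (s : ℝ) :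
    HasDerivAt (fun s => sinkhornMap A r c (fun k => a k + s * d k) i)
      (∑ k, sinkhornKernel A c (fun k => a k + s * d k) i k * d k) s := by
  set b : Fin m → ℝ := fun k => a k + s * d k with hb
  have hS : ∀ j, HasDerivAt (fun s => colWeight A (fun k => a k + s * d k) j)
      (∑ k, A k j * (Real.exp (b k) * d k)) s := fun j => by
    refine HasDerivAt.fun_sum fun k _ => HasDerivAt.const_mul _ (HasDerivAt.exp ?_)
    simpa using ((hasDerivAt_id s).mul_const (d k)).const_add (a k)
  have hh : ∀ j, HasDerivAt (fun s => colScale A c (fun k => a k + s * d k) j)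
      (-(c j * (∑ k, A k j * (Real.exp (b k) * d k))) / colWeight A b j ^ 2) s := fun j => by
    refine ((hasDerivAt_const s (c j)).fun_div (hS j) (h.colWeight_pos _ j).ne').congr_deriv ?_
    simp [hb]
  have hR : HasDerivAt (fun s => rowWeight A c (fun k => a k + s * d k) i)
      (∑ j, A i j * (-(c j * (∑ k, A k j * (Real.exp (b k) * d k))) / colWeight A b j ^ 2)) s :=
    HasDerivAt.fun_sum fun j _ => (hh j).const_mul _
  refine ((hR.log (h.rowWeight_pos _ i).ne').const_sub _).congr_deriv ?_
  rw [← hb, ← neg_div, ← Finset.sum_neg_distrib, Finset.sum_div]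
  simp only [sinkhornKernel, Finset.sum_mul]
  rw [Finset.sum_comm]
  refine Finset.sum_congr rfl fun j _ => ?_
  simp only [mul_neg, neg_div, neg_neg, Finset.mul_sum, Finset.sum_div]
  refine Finset.sum_congr rfl fun k _ => ?_
  have h1 := (h.colWeight_pos b j).ne'
  have h2 := (h.rowWeight_pos b i).ne'
  unfold colScale
  field_simp

lemma continuous_sinkhornMap (h : SinkhornData A r c) (i : Fin m) :
    Continuous fun a => sinkhornMap A r c a i := by
  have hS : ∀ j, Continuous fun a => colWeight A a j := fun j => by
    unfold colWeight
    fun_prop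
  have hh : ∀ j, Continuous fun a => colScale A c a j := fun j =>
    continuous_const.div (hS j) fun a => (h.colWeight_pos a j).ne'
  have hR : Continuous fun a => rowWeight A c a i :=
    continuous_finsetSum _ fun j _ => (hh j).const_mul _
  exact continuous_const.sub (hR.log fun a => (h.rowWeight_pos a i).ne')

end SinkhornData

/-- Doeblin's contraction estimate for two probability vectors with a common lower bound. -/
lemma sum_mul_sub_sum_mul_le (hm : 0 < m) {p q d : Fin m → ℝ} {η ω : ℝ} (hp : ∑ k, p k = 1)
    (hq : ∑ k, q k = 1) (hpη : ∀ k, η / m ≤ p k) (hqη : ∀ k, η / m ≤ q k)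
    (hd : ∀ k l, d k - d l ≤ ω) : ∑ k, p k * d k - ∑ k, q k * d k ≤ (1 - η) * ω := by
  have : Nonempty (Fin m) := ⟨⟨0, hm⟩⟩
  have hm' : (m : ℝ) ≠ 0 := by positivity
  have hη : ∀ p : Fin m → ℝ, ∑ k, p k = 1 → ∑ k, (p k - η / m) = 1 - η := fun p hp => by
    rw [Finset.sum_sub_distrib, hp]
    simp
    field_simp
  obtain ⟨k₁, h₁⟩ := Finite.exists_max d
  obtain ⟨k₀, h₀⟩ := Finite.exists_min d
  have hη1 : 0 ≤ 1 - η := by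
    rw [← hη p hp]
    exact Finset.sum_nonneg fun k _ => sub_nonneg.2 (hpη k)
  have hP : ∑ k, (p k - η / m) * d k ≤ (1 - η) * d k₁ := by
    rw [← hη p hp, Finset.sum_mul]
    exact Finset.sum_le_sum fun k _ => mul_le_mul_of_nonneg_left (h₁ k) (sub_nonneg.2 (hpη k))
  have hQ : (1 - η) * d k₀ ≤ ∑ k, (q k - η / m) * d k := by
    rw [← hη q hq, Finset.sum_mul]
    exact Finset.sum_le_sum fun k _ => mul_le_mul_of_nonneg_left (h₀ k) (sub_nonneg.2 (hqη k))
  simp only [sub_mul, Finset.sum_sub_distrib] at hP hQ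
  have := mul_le_mul_of_nonneg_left (hd k₁ k₀) hη1
  nlinarith

namespace SinkhornData

/-- The mean value inequality on the segment from `a` to `b`: the derivative of a difference of two
coordinates is a difference of two averages of `b - a`, which Doeblin's estimate controls. The
segment keeps oscillation at most `ρ`, so the minorization is available along it. -/
lemma sinkhornMap_contract (h : SinkhornData A r c) (hm : 0 < m) {ρ η ω : ℝ}
    (hker : ∀ a : Fin m → ℝ, (∀ i k, a i - a k ≤ ρ) → ∀ i k, η / m ≤ sinkhornKernel A c a i k)
    {a b : Fin m → ℝ} (ha : ∀ i k, a i - a k ≤ ρ) (hb : ∀ i k, b i - b k ≤ ρ)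
    (hω : ∀ i k, (b i - a i) - (b k - a k) ≤ ω) (i k : Fin m) :
    (sinkhornMap A r c b i - sinkhornMap A r c a i) -
      (sinkhornMap A r c b k - sinkhornMap A r c a k) ≤ (1 - η) * ω := by
  set d : Fin m → ℝ := fun k => b k - a k with hd
  set φ : ℝ → ℝ := fun s => sinkhornMap A r c (fun k => a k + s * d k) i -
    sinkhornMap A r c (fun k => a k + s * d k) k with hφ
  have hderiv := fun s => (h.hasDerivAt_sinkhornMap a d i s).fun_sub
    (h.hasDerivAt_sinkhornMap a d k s)
  have hle := (convex_Icc (0 : ℝ) 1).image_sub_le_mul_sub_of_deriv_le (f := φ) (C := (1 - η) * ω)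
    (fun s _ => (hderiv s).continuousAt.continuousWithinAt)
    (fun s _ => (hderiv s).differentiableAt.differentiableWithinAt)
    (fun s hs => by
      have hs' := interior_subset hs
      rw [(hderiv s).deriv]
      have hosc : ∀ i k, (a i + s * d i) - (a k + s * d k) ≤ ρ := fun i k => by
        have h1 := mul_le_mul_of_nonneg_left (ha i k) (sub_nonneg.2 hs'.2)
        have h2 := mul_le_mul_of_nonneg_left (hb i k) hs'.1
        simp only [hd]
        nlinarith
      exact sum_mul_sub_sum_mul_le hm (h.sum_sinkhornKernel _ i) (h.sum_sinkhornKernel _ k)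
        (hker _ hosc i) (hker _ hosc k) hω)
    0 (by simp) 1 (by simp) zero_le_one
  simp only [hφ, hd, one_mul, zero_mul, add_zero, add_sub_cancel, sub_zero, mul_one] at hle
  linarith

/-- A self-map property and a Doeblin minorization give a fixed point modulo constants. -/
lemma exists_fixed (h : SinkhornData A r c) (hm : 0 < m) {ρ η : ℝ} (hρ : 0 ≤ ρ) (hη : 0 < η)
    (hker : ∀ a : Fin m → ℝ, (∀ i k, a i - a k ≤ ρ) → ∀ i k, η / m ≤ sinkhornKernel A c a i k)
    (hself : ∀ a : Fin m → ℝ, (∀ i k, a i - a k ≤ ρ) →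
      ∀ i k, sinkhornMap A r c a i - sinkhornMap A r c a k ≤ ρ) :
    ∃ a : Fin m → ℝ, (∀ i k, a i - a k ≤ ρ) ∧ (∀ i, |a i| ≤ ρ) ∧
      ∀ i k, sinkhornMap A r c a i - a i = sinkhornMap A r c a k - a k := by
  set i₀ : Fin m := ⟨0, hm⟩
  set T := sinkhornMap A r c with hT
  set S : Set (Fin m → ℝ) := {a | a i₀ = 0 ∧ ∀ i k, a i - a k ≤ ρ} with hS
  have habs : ∀ a ∈ S, ∀ i, |a i| ≤ ρ := fun a ha i => by
    have h1 := ha.2 i i₀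
    have h2 := ha.2 i₀ i
    rw [ha.1] at h1 h2
    exact abs_le.2 ⟨by linarith, by linarith⟩
  have hclosed : IsClosed S := by
    have hSeq : S = {a | a i₀ = 0} ∩ ⋂ i, ⋂ k, {a | a i - a k ≤ ρ} := by
      ext a
      simp [hS]
    rw [hSeq]
    refine (isClosed_eq (continuous_apply i₀) continuous_const).inter ?_
    exact isClosed_iInter fun i => isClosed_iInter fun k =>
      isClosed_le ((continuous_apply i).sub (continuous_apply k)) continuous_const
  have hcompact : IsCompact S := by
    refine Metric.isCompact_of_isClosed_isBounded hclosed
      ((Metric.isBounded_closedBall (x := 0) (r := ρ)).subset fun a ha => ?_)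
    rw [mem_closedBall_zero_iff]
    exact (pi_norm_le_iff_of_nonneg hρ).2 (habs a ha)
  -- `f` measures the oscillation of `T a - a`. It attains its minimum on the compact normalized set
  -- `S`; if the minimum were positive, the normalized image of the minimizer would give a strictly
  -- smaller value, by contraction.
  set f : (Fin m → ℝ) → ℝ := fun a =>
    ‖fun p : Fin m × Fin m => (T a p.1 - a p.1) - (T a p.2 - a p.2)‖ with hf
  have hfc : Continuous f := by
    refine continuous_norm.comp (continuous_pi fun p => ?_)
    exact ((h.continuous_sinkhornMap p.1).sub (continuous_apply _)).sub
      ((h.continuous_sinkhornMap p.2).sub (continuous_apply _))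
  obtain ⟨a, haS, hmin⟩ := hcompact.exists_isMinOn
    ⟨0, by simp [hS, hρ]⟩ hfc.continuousOn
  refine ⟨a, haS.2, habs a haS, ?_⟩
  have hfa : ∀ i k, |(T a i - a i) - (T a k - a k)| ≤ f a := fun i k =>
    norm_le_pi_norm (fun p : Fin m × Fin m => (T a p.1 - a p.1) - (T a p.2 - a p.2)) (i, k)
  have hzero : f a ≤ 0 := by
    by_contra! hpos
    set b : Fin m → ℝ := fun i => T a i - T a i₀ with hb
    have hbS : b ∈ S := ⟨by simp [hb], fun i k => by
      have := hself a haS.2 i k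
      simp only [hb]
      linarith⟩
    have hcon := h.sinkhornMap_contract hm (r := r) hker (ω := f a) haS.2 hbS.2 fun i k => by
      have := le_of_abs_le (hfa i k)
      simp only [hb]
      linarith
    have hfb : f b ≤ (1 - η) * f a := by
      have h0 : 0 ≤ (1 - η) * f a := by simpa using hcon i₀ i₀
      refine (pi_norm_le_iff_of_nonneg h0).2 fun p => ?_
      rw [Real.norm_eq_abs, abs_le]
      have h1 := hcon p.1 p.2
      have h2 := hcon p.2 p.1
      simp only [hb] at h1 h2 ⊢
      constructor <;> linarith
    have := isMinOn_iff.1 hmin b hbS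
    nlinarith
  intro i k
  have := abs_nonpos_iff.1 ((hfa i k).trans hzero)
  linarith

/-- Column sums are correct by the definition of the column scaling, and row sums are correct up to
one common factor. Comparing total masses forces this factor to be one. -/
lemma isPotentials_of_fixed (h : SinkhornData A r c) (hm : 0 < m) (hrc : ∑ i, r i = ∑ j, c j)
    {a : Fin m → ℝ} (ha : ∀ i k, sinkhornMap A r c a i - a i = sinkhornMap A r c a k - a k) :
    IsPotentials A r c a fun j => Real.log (colScale A c a j) := by
  have happ : ∀ i j, rescale a A (fun j => Real.log (colScale A c a j)) i j =
      Real.exp (a i) * A i j * colScale A c a j := fun i j => by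
    rw [rescale_apply, Real.exp_log (h.colScale_pos a j)]
  have hcol : ∀ j, ∑ i, Real.exp (a i) * A i j * colScale A c a j = c j := fun j => by
    rw [← Finset.sum_mul]
    have : ∑ i, Real.exp (a i) * A i j = colWeight A a j :=
      Finset.sum_congr rfl fun i _ => mul_comm _ _
    rw [this]
    exact mul_div_cancel₀ _ (h.colWeight_pos a j).ne'
  set i₀ : Fin m := ⟨0, hm⟩
  set s := sinkhornMap A r c a i₀ - a i₀ with hs
  have hrow : ∀ i, ∑ j, Real.exp (a i) * A i j * colScale A c a j = r i * Real.exp (-s) :=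
    fun i => by
      have h1 : ∑ j, Real.exp (a i) * A i j * colScale A c a j =
          Real.exp (a i) * rowWeight A c a i := by
        rw [rowWeight, Finset.mul_sum]
        exact Finset.sum_congr rfl fun j _ => by ring
      have h2 : Real.log (rowWeight A c a i) = Real.log (r i) - (a i + s) := by
        have := ha i i₀
        rw [sinkhornMap] at this
        linarith
      rw [h1, ← Real.exp_log (h.rowWeight_pos a i), h2, ← Real.exp_add,
        show a i + (Real.log (r i) - (a i + s)) = Real.log (r i) + -s by ring, Real.exp_add,
        Real.exp_log (h.row_pos i)]
  have hexp : Real.exp (-s) = 1 := by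
    have h1 : ∑ i, r i * Real.exp (-s) = ∑ i, r i := by
      rw [hrc]
      simp only [← hrow, ← hcol]
      exact Finset.sum_comm
    have h2 : 0 < ∑ i, r i := Finset.sum_pos (fun i _ => h.row_pos i) ⟨i₀, Finset.mem_univ _⟩
    rw [← Finset.sum_mul] at h1
    exact mul_left_cancel₀ h2.ne' (by rw [h1, mul_one])
  refine ⟨fun i j => ?_, fun i => ?_, fun j => ?_⟩
  · rw [happ]
    exact mul_nonneg (mul_nonneg (Real.exp_nonneg _) (h.nonneg i j)) (h.colScale_pos a j).le
  · simp only [happ, hrow, hexp, mul_one]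
  · simp only [happ, hcol]

end SinkhornData

/-- Sinkhorn's theorem for a positive matrix. -/
lemma exists_isPotentials_of_pos (hm : 0 < m) (hn : 0 < n) (hA : ∀ i j, 0 < A i j)
    (hr : ∀ i, 0 < r i) (hc : ∀ j, 0 < c j) (hrc : ∑ i, r i = ∑ j, c j) :
    ∃ α β, IsPotentials A r c α β := by
  have h : SinkhornData A r c := ⟨fun i j => (hA i j).le, fun i => ⟨⟨0, hn⟩, hA _ _⟩,
    fun j => ⟨⟨0, hm⟩, hA _ _⟩, hr, hc⟩
  have : Nonempty (Fin m) := ⟨⟨0, hm⟩⟩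
  have : Nonempty (Fin n) := ⟨⟨0, hn⟩⟩
  have hmR : (0 : ℝ) < m := Nat.cast_pos.2 hm
  obtain ⟨lo, hi, hlo, hloA, hhiA⟩ : ∃ lo hi : ℝ, 0 < lo ∧ (∀ i j, lo ≤ A i j) ∧
      ∀ i j, A i j ≤ hi := by
    obtain ⟨p, hp⟩ := Finite.exists_min fun p : Fin m × Fin n => A p.1 p.2
    obtain ⟨q, hq⟩ := Finite.exists_max fun p : Fin m × Fin n => A p.1 p.2
    exact ⟨_, _, hA p.1 p.2, fun i j => hp (i, j), fun i j => hq (i, j)⟩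
  obtain ⟨i₁, hr₁⟩ := Finite.exists_max r
  obtain ⟨i₂, hr₂⟩ := Finite.exists_min r
  have hlohi : lo ≤ hi := (hloA ⟨0, hm⟩ ⟨0, hn⟩).trans (hhiA _ _)
  have hhi : 0 < hi := hlo.trans_le hlohi
  -- This bounds the oscillation of every value of the Sinkhorn map, since row weights vary at most
  -- by the ratio `hi / lo`.
  set ρ := (Real.log (r i₁) - Real.log (r i₂)) + (Real.log hi - Real.log lo) with hρ
  have hρ0 : 0 ≤ ρ := add_nonneg (sub_nonneg.2 (Real.log_le_log (hr _) (hr₁ _)))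
    (sub_nonneg.2 (Real.log_le_log hlo hlohi))
  have hself : ∀ a : Fin m → ℝ, ∀ i k, sinkhornMap A r c a i - sinkhornMap A r c a k ≤ ρ :=
    fun a i k => by
      set H := ∑ j, colScale A c a j
      have hH : 0 < H := Finset.sum_pos (fun j _ => h.colScale_pos a j) Finset.univ_nonempty
      have h1 : lo * H ≤ rowWeight A c a i := by
        rw [Finset.mul_sum]
        exact Finset.sum_le_sum fun j _ =>
          mul_le_mul_of_nonneg_right (hloA i j) (h.colScale_pos a j).le
      have h2 : rowWeight A c a k ≤ hi * H := by
        rw [Finset.mul_sum]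
        exact Finset.sum_le_sum fun j _ =>
          mul_le_mul_of_nonneg_right (hhiA k j) (h.colScale_pos a j).le
      have h3 := Real.log_le_log (mul_pos hlo hH) h1
      have h4 := Real.log_le_log (h.rowWeight_pos a k) h2
      rw [Real.log_mul hlo.ne' hH.ne'] at h3
      rw [Real.log_mul hhi.ne' hH.ne'] at h4
      have h5 := Real.log_le_log (hr i) (hr₁ i)
      have h6 := Real.log_le_log (hr i₂) (hr₂ k)
      unfold sinkhornMap
      linarith
  have hker : ∀ a : Fin m → ℝ, (∀ i k, a i - a k ≤ ρ) →
      ∀ i k, lo / (hi * Real.exp ρ) / m ≤ sinkhornKernel A c a i k := fun a ha i k => by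
    -- The second factor of the kernel is bounded below uniformly in `j`; the first factors sum to
    -- one over `j`.
    have h1 : ∀ j, lo / (hi * Real.exp ρ) / m ≤ A k j * Real.exp (a k) / colWeight A a j :=
      fun j => by
        have h2 : colWeight A a j ≤ m * (hi * (Real.exp ρ * Real.exp (a k))) := by
          have : ∀ l ∈ Finset.univ, A l j * Real.exp (a l) ≤
              hi * (Real.exp ρ * Real.exp (a k)) := fun l _ => by
            rw [← Real.exp_add]
            exact mul_le_mul (hhiA l j) (Real.exp_le_exp.2 (by linarith [ha l k]))
              (Real.exp_nonneg _) hhi.le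
          rw [colWeight]
          simpa using Finset.sum_le_card_nsmul _ _ _ this
        rw [div_div, div_le_div_iff₀ (by positivity) (h.colWeight_pos a j)]
        calc lo * colWeight A a j ≤ lo * (m * (hi * (Real.exp ρ * Real.exp (a k)))) :=
              mul_le_mul_of_nonneg_left h2 hlo.le
          _ ≤ A k j * (m * (hi * (Real.exp ρ * Real.exp (a k)))) :=
              mul_le_mul_of_nonneg_right (hloA k j) (by positivity)
          _ = _ := by ring
    calc lo / (hi * Real.exp ρ) / m
        = ∑ j, (A i j * colScale A c a j / rowWeight A c a i) *
            (lo / (hi * Real.exp ρ) / m) := by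
          rw [← Finset.sum_mul, ← Finset.sum_div]
          exact ((congrArg (· * _) (div_self (h.rowWeight_pos a i).ne')).trans (one_mul _)).symm
      _ ≤ _ := Finset.sum_le_sum fun j _ => mul_le_mul_of_nonneg_left (h1 j)
          (div_nonneg (mul_nonneg (hA i j).le (h.colScale_pos a j).le) (h.rowWeight_pos a i).le)
  obtain ⟨a, -, -, ha⟩ := h.exists_fixed hm hρ0 (η := lo / (hi * Real.exp ρ)) (by positivity) hker
    fun a _ => hself a
  exact ⟨a, _, h.isPotentials_of_fixed hm hrc ha⟩

end Sinkhorn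

/-! ### Potentials of a matrix with almost correct margins. -/

section Perturbation

variable {m n : ℕ} {A : Matrix (Fin m) (Fin n) ℝ} {r : Fin m → ℝ} {c : Fin n → ℝ}

/-- Sandwich bounds for the column and row weights of a matrix with almost correct margins. -/
lemma SinkhornData.weight_bounds (h : SinkhornData A r c) {ε u v : ℝ} (hε0 : 0 ≤ ε) (hε1 : ε < 1)
    (hrow : ∀ i, |∑ j, A i j - r i| ≤ ε * r i) (hcol : ∀ j, |∑ i, A i j - c j| ≤ ε * c j)
    {a : Fin m → ℝ} (hu : 0 < u) (hv : 0 < v) (hau : ∀ k, u ≤ Real.exp (a k))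
    (hav : ∀ k, Real.exp (a k) ≤ v) :
    (∀ j, (1 - ε) * c j * u ≤ colWeight A a j ∧ colWeight A a j ≤ (1 + ε) * c j * v) ∧
    (∀ j, ((1 + ε) * v)⁻¹ ≤ colScale A c a j ∧ colScale A c a j ≤ ((1 - ε) * u)⁻¹) ∧
    ∀ i, (1 - ε) * r i * ((1 + ε) * v)⁻¹ ≤ rowWeight A c a i ∧
      rowWeight A c a i ≤ (1 + ε) * r i * ((1 - ε) * u)⁻¹ := by
  have h1ε : 0 < 1 - ε := sub_pos.2 hε1
  have hS : ∀ j, (1 - ε) * c j * u ≤ colWeight A a j ∧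
      colWeight A a j ≤ (1 + ε) * c j * v := fun j => by
    have h1 := abs_le.1 (hcol j)
    have h2 : (∑ i, A i j) * u ≤ colWeight A a j := by
      rw [colWeight, Finset.sum_mul]
      exact Finset.sum_le_sum fun k _ => mul_le_mul_of_nonneg_left (hau k) (h.nonneg k j)
    have h3 : colWeight A a j ≤ (∑ i, A i j) * v := by
      rw [colWeight, Finset.sum_mul]
      exact Finset.sum_le_sum fun k _ => mul_le_mul_of_nonneg_left (hav k) (h.nonneg k j)
    exact ⟨le_trans (mul_le_mul_of_nonneg_right (by linarith) hu.le) h2,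
      h3.trans (mul_le_mul_of_nonneg_right (by linarith) hv.le)⟩
  have hh : ∀ j, ((1 + ε) * v)⁻¹ ≤ colScale A c a j ∧ colScale A c a j ≤ ((1 - ε) * u)⁻¹ :=
    fun j => by
      have hc := h.col_pos j
      constructor
      · rw [colScale, inv_eq_one_div, div_le_div_iff₀ (by positivity) (h.colWeight_pos a j)]
        linarith [(hS j).2]
      · rw [colScale, inv_eq_one_div, div_le_div_iff₀ (h.colWeight_pos a j) (by positivity)]
        linarith [(hS j).1]
  refine ⟨hS, hh, fun i => ?_⟩
  have h1 := abs_le.1 (hrow i)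
  have h2 : (∑ j, A i j) * ((1 + ε) * v)⁻¹ ≤ rowWeight A c a i := by
    rw [rowWeight, Finset.sum_mul]
    exact Finset.sum_le_sum fun j _ => mul_le_mul_of_nonneg_left (hh j).1 (h.nonneg i j)
  have h3 : rowWeight A c a i ≤ (∑ j, A i j) * ((1 - ε) * u)⁻¹ := by
    rw [rowWeight, Finset.sum_mul]
    exact Finset.sum_le_sum fun j _ => mul_le_mul_of_nonneg_left (hh j).2 (h.nonneg i j)
  exact ⟨le_trans (mul_le_mul_of_nonneg_right (by linarith) (by positivity)) h2,
    h3.trans (mul_le_mul_of_nonneg_right (by linarith) (by positivity))⟩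

lemma exp_le_of_le_one_div_twenty {ρ : ℝ} (hρ0 : 0 ≤ ρ) (hρ : ρ ≤ 1 / 20) :
    Real.exp ρ ≤ 11 / 10 := by
  refine (Real.exp_bound_div_one_sub_of_interval hρ0 (by linarith)).trans ?_
  rw [div_le_iff₀ (by linarith)]
  linarith

/-- At `a = 0` and with exact margins the kernel equals `∑ j, A i j * A k j / (r i * c j)`, which
`halign` bounds by `η / m`. Errors in the margins and oscillation of `a` cost at most a factor `2`;
the common scale `u` of `e^a` cancels. -/
lemma SinkhornData.sinkhornKernel_ge (h : SinkhornData A r c) (hm : 0 < m) {ε η ρ : ℝ}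
    (hε0 : 0 ≤ ε) (hε : ε ≤ 1 / 100) (hρ0 : 0 ≤ ρ) (hρ : ρ ≤ 1 / 20)
    (hrow : ∀ i, |∑ j, A i j - r i| ≤ ε * r i) (hcol : ∀ j, |∑ i, A i j - c j| ≤ ε * c j)
    (halign : ∀ i k, η * r i / m ≤ ∑ j, A i j * A k j / c j) {a : Fin m → ℝ}
    (ha : ∀ i k, a i - a k ≤ ρ) (i k : Fin m) : η / 2 / m ≤ sinkhornKernel A c a i k := by
  have : Nonempty (Fin m) := ⟨⟨0, hm⟩⟩
  have hmR : (0 : ℝ) < m := Nat.cast_pos.2 hm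
  have h1ε : 0 < 1 - ε := by linarith
  obtain ⟨k₀, hk₀⟩ := Finite.exists_min a
  set u := Real.exp (a k₀) with hu
  set E := Real.exp ρ with hE
  have hu0 : 0 < u := Real.exp_pos _
  have hE1 : 1 ≤ E := Real.one_le_exp hρ0
  have hE2 : E ≤ 11 / 10 := exp_le_of_le_one_div_twenty hρ0 hρ
  have hE0 : 0 < E := by linarith
  have hau : ∀ k, u ≤ Real.exp (a k) := fun k => Real.exp_le_exp.2 (hk₀ k)
  have hav : ∀ k, Real.exp (a k) ≤ u * E := fun k => by
    rw [hu, hE, ← Real.exp_add]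
    exact Real.exp_le_exp.2 (by linarith [ha k k₀])
  obtain ⟨hS, hh, hR⟩ := h.weight_bounds hε0 (by linarith) hrow hcol hu0 (by positivity) hau hav
  have hri := h.row_pos i
  have hfac : 1 / 2 ≤ (1 - ε) / ((1 + ε) ^ 3 * E ^ 2) := by
    have h2 : (1 + ε) ^ 3 ≤ (101 / 100) ^ 3 := pow_le_pow_left₀ (by linarith) (by linarith) 3
    have h3 : E ^ 2 ≤ (11 / 10) ^ 2 := pow_le_pow_left₀ hE0.le hE2 2
    have h4 : (1 + ε) ^ 3 * E ^ 2 ≤ (101 / 100) ^ 3 * (11 / 10) ^ 2 :=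
      mul_le_mul h2 h3 (by positivity) (by norm_num)
    rw [div_le_div_iff₀ (by norm_num) (by positivity)]
    norm_num at h4
    linarith
  have hterm : ∀ j, 1 / 2 / r i * (A i j * A k j / c j) ≤
      (A i j * colScale A c a j / rowWeight A c a i) *
        (A k j * Real.exp (a k) / colWeight A a j) := fun j => by
    have hc := h.col_pos j
    have hAA : 0 ≤ A i j * A k j := mul_nonneg (h.nonneg i j) (h.nonneg k j)
    have h1 : ((1 + ε) * (u * E))⁻¹ * u /
        ((1 + ε) * r i * ((1 - ε) * u)⁻¹ * ((1 + ε) * c j * (u * E))) ≤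
        colScale A c a j * Real.exp (a k) / (rowWeight A c a i * colWeight A a j) := by
      have := h.rowWeight_pos a i
      have := h.colWeight_pos a j
      have := h.colScale_pos a j
      exact div_le_div₀ (by positivity)
        (mul_le_mul (hh j).1 (hau k) hu0.le (h.colScale_pos a j).le) (by positivity)
        (mul_le_mul (hR i).2 (hS j).2 (h.colWeight_pos a j).le (by positivity))
    have h2 : ((1 + ε) * (u * E))⁻¹ * u /
        ((1 + ε) * r i * ((1 - ε) * u)⁻¹ * ((1 + ε) * c j * (u * E))) =
        (1 - ε) / ((1 + ε) ^ 3 * E ^ 2) / (r i * c j) := by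
      field_simp
    rw [h2] at h1
    have h3 : 1 / 2 / (r i * c j) ≤ (1 - ε) / ((1 + ε) ^ 3 * E ^ 2) / (r i * c j) :=
      div_le_div_of_nonneg_right hfac (by positivity)
    calc _ = A i j * A k j * (1 / 2 / (r i * c j)) := by field_simp
      _ ≤ A i j * A k j *
          (colScale A c a j * Real.exp (a k) / (rowWeight A c a i * colWeight A a j)) :=
        mul_le_mul_of_nonneg_left (h3.trans h1) hAA
      _ = _ := by
        have h4 := (h.rowWeight_pos a i).ne'
        have h5 := (h.colWeight_pos a j).ne'
        field_simp
  calc η / 2 / m = 1 / 2 / r i * (η * r i / m) := by field_simp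
    _ ≤ 1 / 2 / r i * ∑ j, A i j * A k j / c j :=
      mul_le_mul_of_nonneg_left (halign i k) (by positivity)
    _ ≤ _ := by
      rw [Finset.mul_sum]
      exact Finset.sum_le_sum fun j _ => hterm j

lemma abs_log_le_of_mem {x y z : ℝ} (hx0 : 0 < x) (hxy : x ≤ y) (hyz : y ≤ z) {δ : ℝ}
    (hz : z ≤ 1 + δ) (hx : 1 ≤ (1 + δ) * x) : |Real.log y| ≤ δ := by
  have hy : 0 < y := hx0.trans_le hxy
  have h1 := Real.log_le_sub_one_of_pos hy
  have h2 := Real.one_sub_inv_le_log_of_pos hy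
  have hδ : 0 < 1 + δ := pos_of_mul_pos_left (zero_lt_one.trans_le hx) hx0.le
  have h3 : y⁻¹ ≤ 1 + δ := by
    rw [inv_le_iff_one_le_mul₀ hy]
    exact hx.trans (mul_le_mul_of_nonneg_left hxy hδ.le)
  exact abs_le.2 ⟨by linarith, by linarith⟩

/-- A matrix with almost correct margins and aligned rows has potentials close to zero. -/
lemma SinkhornData.exists_isPotentials_near (h : SinkhornData A r c) (hm : 0 < m)
    (hrc : ∑ i, r i = ∑ j, c j) {ε η ρ : ℝ}
    (hε0 : 0 ≤ ε) (hε : ε ≤ 1 / 100) (hρ0 : 0 ≤ ρ) (hρ : ρ ≤ 1 / 20) (hη : 0 < η)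
    (hηρ : 10 * ε ≤ η * ρ)
    (hrow : ∀ i, |∑ j, A i j - r i| ≤ ε * r i) (hcol : ∀ j, |∑ i, A i j - c j| ≤ ε * c j)
    (halign : ∀ i k, η * r i / m ≤ ∑ j, A i j * A k j / c j) :
    ∃ a b, IsPotentials A r c a b ∧ (∀ i, |a i| ≤ ρ) ∧ ∀ j, |b j| ≤ ρ + 2 * ε := by
  have h1ε : 0 < 1 - ε := by linarith
  have hker : ∀ a : Fin m → ℝ, (∀ i k, a i - a k ≤ ρ) →
      ∀ i k, η / 2 / m ≤ sinkhornKernel A c a i k := fun a ha =>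
    h.sinkhornKernel_ge hm hε0 hε hρ0 hρ hrow hcol halign ha
  -- The row weight at `0` differs from `r i` by a factor at most `(1 + ε) / (1 - ε)`, in either
  -- direction.
  have hzero : ∀ i, |sinkhornMap A r c 0 i| ≤ 5 / 2 * ε := fun i => by
    obtain ⟨-, -, hR⟩ := h.weight_bounds hε0 (by linarith) hrow hcol (a := 0) zero_lt_one
      zero_lt_one (by simp) (by simp)
    obtain ⟨h1, h2⟩ := hR i
    have hri := h.row_pos i
    rw [mul_one] at h1 h2
    rw [sinkhornMap, ← neg_sub, abs_neg, ← Real.log_div (h.rowWeight_pos 0 i).ne' hri.ne']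
    refine abs_log_le_of_mem (x := (1 - ε) * (1 + ε)⁻¹) (z := (1 + ε) * (1 - ε)⁻¹)
      (by positivity) ?_ ?_ ?_ ?_
    · rw [le_div_iff₀ hri]
      linarith
    · rw [div_le_iff₀ hri]
      linarith
    · rw [← div_eq_mul_inv, div_le_iff₀ h1ε]
      nlinarith
    · rw [← div_eq_mul_inv, ← mul_div_assoc, le_div_iff₀ (by linarith)]
      nlinarith
  -- The image of `0` has oscillation at most `5ε` and the contraction factor is `1 - η / 2`, so
  -- stability needs `(1 - η / 2) ρ + 5ε ≤ ρ`. This is the condition `hηρ`.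
  have hself : ∀ a : Fin m → ℝ, (∀ i k, a i - a k ≤ ρ) →
      ∀ i k, sinkhornMap A r c a i - sinkhornMap A r c a k ≤ ρ := fun a ha i k => by
    have h1 := h.sinkhornMap_contract hm hker (a := 0) (b := a) (ω := ρ) (fun _ _ => by simpa using hρ0) ha
      (by simpa using ha) i k
    have h2 := abs_le.1 (hzero i)
    have h3 := abs_le.1 (hzero k)
    linarith
  obtain ⟨a, ha, habs, hfix⟩ := h.exists_fixed hm hρ0 (half_pos hη) hker hself
  refine ⟨a, _, h.isPotentials_of_fixed hm hrc hfix, habs, fun j => ?_⟩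
  obtain ⟨-, hh, -⟩ := h.weight_bounds hε0 (by linarith) hrow hcol (a := a)
    (Real.exp_pos (-ρ)) (Real.exp_pos ρ)
    (fun k => Real.exp_le_exp.2 (abs_le.1 (habs k)).1)
    (fun k => Real.exp_le_exp.2 (abs_le.1 (habs k)).2)
  obtain ⟨h1, h2⟩ := hh j
  have hl1 := Real.log_le_log (by positivity) h1
  have hl2 := Real.log_le_log (h.colScale_pos a j) h2
  rw [Real.log_inv, Real.log_mul (by positivity) (by positivity), Real.log_exp] at hl1 hl2
  have h3 := abs_le.1 (abs_log_le_of_mem (x := 1 + ε) (y := 1 + ε) (z := 1 + ε) (δ := 2 * ε)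
    (by linarith) le_rfl le_rfl (by linarith) (by nlinarith))
  have h4 := abs_le.1 (abs_log_le_of_mem (x := 1 - ε) (y := 1 - ε) (z := 1 - ε) (δ := 2 * ε)
    (by linarith) le_rfl le_rfl (by linarith) (by nlinarith))
  exact abs_le.2 ⟨by linarith, by linarith⟩

/-! ### Uniqueness of potentials up to a shift. -/

lemma exp_sub_one_mul_self_nonneg (w : ℝ) : 0 ≤ (Real.exp w - 1) * w := by
  rcases le_total 0 w with h | h
  · exact mul_nonneg (sub_nonneg.2 (Real.one_le_exp h)) h
  · exact mul_nonneg_of_nonpos_of_nonpos (sub_nonpos.2 (Real.exp_le_one_iff.2 h)) h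

/-- Potentials of a connected matrix are unique up to a shift. -/
lemma IsPotentials.add_eq_add {α α' : Fin m → ℝ} {β β' : Fin n → ℝ}
    (hconn : ∀ i k, ∃ j, 0 < A i j ∧ 0 < A k j)
    (hcol : ∀ j, ∃ i, 0 < A i j) (h₁ : IsPotentials A r c α β) (h₂ : IsPotentials A r c α' β')
    (i : Fin m) (j : Fin n) : α i + β j = α' i + β' j := by
  set u : Fin m → ℝ := fun i => α' i - α i with hu
  set v : Fin n → ℝ := fun j => β' j - β j with hv
  have hterm : ∀ i j, rescale α A β i j * ((Real.exp (u i + v j) - 1) * (u i + v j)) =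
      (rescale α' A β' i j - rescale α A β i j) * u i +
        (rescale α' A β' i j - rescale α A β i j) * v j := fun i j => by
    have : rescale α' A β' i j = rescale α A β i j * Real.exp (u i + v j) := by
      rw [rescale_apply, rescale_apply, Real.exp_add]
      have h1 : Real.exp (α' i) = Real.exp (α i) * Real.exp (u i) := by
        rw [← Real.exp_add]
        simp [hu]
      have h2 : Real.exp (β' j) = Real.exp (β j) * Real.exp (v j) := by
        rw [← Real.exp_add]
        simp [hv]
      rw [h1, h2]
      ring
    rw [this]
    ring
  -- Pairing the difference of the two rescalings with `u i + v j` gives zero because their margins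
  -- agree. The terms are nonnegative by monotonicity of `exp`, so `u i + v j = 0` on the support of
  -- `A`.
  have hsum : ∑ i, ∑ j, rescale α A β i j * ((Real.exp (u i + v j) - 1) * (u i + v j)) = 0 := by
    simp only [hterm, Finset.sum_add_distrib]
    have h1 : ∑ i, ∑ j, (rescale α' A β' i j - rescale α A β i j) * u i = 0 :=
      Finset.sum_eq_zero fun i _ => by
        rw [← Finset.sum_mul, Finset.sum_sub_distrib, h₁.2.1, h₂.2.1, sub_self, zero_mul]
    have h2 : ∑ i, ∑ j, (rescale α' A β' i j - rescale α A β i j) * v j = 0 := by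
      rw [Finset.sum_comm]
      exact Finset.sum_eq_zero fun j _ => by
        rw [← Finset.sum_mul, Finset.sum_sub_distrib, h₁.2.2, h₂.2.2, sub_self, zero_mul]
    rw [h1, h2, add_zero]
  have hnn : ∀ i j, 0 ≤ rescale α A β i j * ((Real.exp (u i + v j) - 1) * (u i + v j)) :=
    fun i j => mul_nonneg (h₁.1 i j) (exp_sub_one_mul_self_nonneg _)
  have hzero : ∀ i j, 0 < A i j → u i + v j = 0 := fun i j hij => by
    have h1 := (Finset.sum_eq_zero_iff_of_nonneg fun i _ =>
      Finset.sum_nonneg fun j _ => hnn i j).1 hsum i (Finset.mem_univ i)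
    have h2 := (Finset.sum_eq_zero_iff_of_nonneg fun j _ => hnn i j).1 h1 j (Finset.mem_univ j)
    have hpos : rescale α A β i j ≠ 0 := by
      rw [rescale_apply]
      positivity
    rcases mul_eq_zero.1 ((mul_eq_zero.1 h2).resolve_left hpos) with h3 | h3
    · exact (Real.exp_eq_one_iff _).1 (by linarith)
    · exact h3
  -- The entry `(i, j)` may vanish: row `k` meets column `j` in the support, and rows `i` and `k`
  -- share a column `l`, so `u i = -v l = u k = -v j`.
  obtain ⟨k, hk⟩ := hcol j
  obtain ⟨l, hil, hkl⟩ := hconn i k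
  have h1 := hzero k j hk
  have h2 := hzero i l hil
  have h3 := hzero k l hkl
  simp only [hu, hv] at h1 h2 h3
  linarith

/-! ### Size of the potentials of the mean matrix. -/

lemma one_le_exp_add_mul_exp (u : ℝ) : Real.exp u - 1 ≤ u * Real.exp u := by
  have h := mul_le_mul_of_nonneg_right (Real.add_one_le_exp (-u)) (Real.exp_pos u).le
  rw [← Real.exp_add, neg_add_cancel, Real.exp_zero] at h
  linarith

/-- Two-sided bounds for the potentials of the mean matrix. -/
lemma IsPotentials.exp_bounds {Λ : Matrix (Fin m) (Fin n) ℝ} {K : ℝ} {α : Fin m → ℝ}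
    {β : Fin n → ℝ} (hΛ : ∀ i j, 0 < Λ i j) (hr : ∀ i, 0 < r i) (hc : ∀ j, 0 < c j)
    (hrc : ∑ i, r i = ∑ j, c j) (hK : IsBoundedCost Λ r c K) (h : IsPotentials Λ r c α β)
    (i : Fin m) (j : Fin n) :
    Real.exp (α i + β j) ≤ Real.exp (2 * K) * ((∑ i, r i) / entryL1 Λ) ∧
      Real.exp (-(3 * K)) * ((∑ i, r i) / entryL1 Λ) ≤ Real.exp (α i + β j) := by
  set N := ∑ i, r i with hN
  set L := entryL1 Λ with hL
  have hN0 : 0 < N := Finset.sum_pos (fun i _ => hr i) ⟨i, Finset.mem_univ i⟩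
  have hLsum : L = ∑ i, ∑ j, Λ i j := by
    simp only [hL, entryL1, abs_of_pos (hΛ _ _)]
  have hL0 : 0 < L := by
    rw [hLsum]
    exact Finset.sum_pos (fun i _ => Finset.sum_pos (fun j _ => hΛ i j) ⟨j, Finset.mem_univ j⟩)
      ⟨i, Finset.mem_univ i⟩
  set κ := L / N ^ 2 with hκ
  have hκ0 : 0 < κ := by positivity
  have hcost : ∀ i j, Real.exp (-K) * κ * (r i * c j) ≤ Λ i j ∧
      Λ i j ≤ Real.exp K * κ * (r i * c j) := fun i j => by
    have hri := hr i
    have hcj := hc j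
    have hij := hΛ i j
    obtain ⟨h1, h2⟩ := abs_le.1 (hK.bound i j)
    rw [Real.le_log_iff_exp_le (by positivity), le_div_iff₀ (by positivity)] at h1
    rw [Real.log_le_iff_le_exp (by positivity), div_le_iff₀ (by positivity)] at h2
    have hKK : Real.exp (-K) * Real.exp K = 1 := by rw [← Real.exp_add]; simp
    have hre : κ * (r i * c j) = r i * c j * L / N ^ 2 := by rw [hκ]; ring
    constructor
    · rw [mul_assoc, hre, ← mul_div_assoc, div_le_iff₀ (by positivity)]
      calc Real.exp (-K) * (r i * c j * L) ≤ Real.exp (-K) * (Real.exp K * (Λ i j * N ^ 2)) :=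
            mul_le_mul_of_nonneg_left h2 (Real.exp_nonneg _)
        _ = _ := by rw [← mul_assoc, hKK, one_mul]
    · rw [mul_assoc, hre, ← mul_div_assoc, le_div_iff₀ (by positivity)]
      calc Λ i j * N ^ 2 = Real.exp K * (Real.exp (-K) * (Λ i j * N ^ 2)) := by
            rw [← mul_assoc, mul_comm (Real.exp K), hKK, one_mul]
        _ ≤ _ := mul_le_mul_of_nonneg_left h1 (Real.exp_nonneg _)
  set f : Fin m → ℝ := fun i => Real.exp (α i) with hf
  set g : Fin n → ℝ := fun j => Real.exp (β j) with hg
  have hf0 : ∀ i, 0 < f i := fun i => Real.exp_pos _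
  have hg0 : ∀ j, 0 < g j := fun j => Real.exp_pos _
  set F := ∑ i, f i * r i with hF
  set G := ∑ j, g j * c j with hG
  have hF0 : 0 < F := Finset.sum_pos (fun i _ => mul_pos (hf0 i) (hr i)) ⟨i, Finset.mem_univ i⟩
  have hG0 : 0 < G := Finset.sum_pos (fun j _ => mul_pos (hg0 j) (hc j)) ⟨j, Finset.mem_univ j⟩
  have hrow : ∀ i, f i * ∑ j, Λ i j * g j = r i := fun i => by
    rw [← h.2.1 i, Finset.mul_sum]
    exact Finset.sum_congr rfl fun j _ => by rw [rescale_apply]; ring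
  have hcol : ∀ j, g j * ∑ i, Λ i j * f i = c j := fun j => by
    rw [← h.2.2 j, Finset.mul_sum]
    exact Finset.sum_congr rfl fun i _ => by rw [rescale_apply]; ring
  have hrowG : ∀ i, Real.exp (-K) * κ * r i * G ≤ ∑ j, Λ i j * g j ∧
      ∑ j, Λ i j * g j ≤ Real.exp K * κ * r i * G := fun i => by
    rw [hG, Finset.mul_sum, Finset.mul_sum]
    exact ⟨Finset.sum_le_sum fun j _ => by
        nlinarith [mul_le_mul_of_nonneg_right (hcost i j).1 (hg0 j).le],
      Finset.sum_le_sum fun j _ => by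
        nlinarith [mul_le_mul_of_nonneg_right (hcost i j).2 (hg0 j).le]⟩
  have hcolF : ∀ j, Real.exp (-K) * κ * c j * F ≤ ∑ i, Λ i j * f i ∧
      ∑ i, Λ i j * f i ≤ Real.exp K * κ * c j * F := fun j => by
    rw [hF, Finset.mul_sum, Finset.mul_sum]
    exact ⟨Finset.sum_le_sum fun i _ => by
        nlinarith [mul_le_mul_of_nonneg_right (hcost i j).1 (hf0 i).le],
      Finset.sum_le_sum fun i _ => by
        nlinarith [mul_le_mul_of_nonneg_right (hcost i j).2 (hf0 i).le]⟩
  -- Since `Λ i j` is `κ r i c j` up to `e^(±K)`, each row equation fixes `f i * G` up to the same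
  -- factor. With the column equations it remains to locate `F * G`.
  have hfG : ∀ i, Real.exp (-K) * κ * (f i * G) ≤ 1 ∧ 1 ≤ Real.exp K * κ * (f i * G) := fun i => by
    have h1 := mul_le_mul_of_nonneg_left (hrowG i).1 (hf0 i).le
    have h2 := mul_le_mul_of_nonneg_left (hrowG i).2 (hf0 i).le
    rw [hrow] at h1 h2
    exact ⟨le_of_mul_le_mul_right (by linarith) (hr i),
      le_of_mul_le_mul_right (by linarith) (hr i)⟩
  have hgF : Real.exp (-K) * κ * (g j * F) ≤ 1 ∧ 1 ≤ Real.exp K * κ * (g j * F) := by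
    have h1 := mul_le_mul_of_nonneg_left (hcolF j).1 (hg0 j).le
    have h2 := mul_le_mul_of_nonneg_left (hcolF j).2 (hg0 j).le
    rw [hcol] at h1 h2
    exact ⟨le_of_mul_le_mul_right (by linarith) (hc j),
      le_of_mul_le_mul_right (by linarith) (hc j)⟩
  have hFG_le : Real.exp (-K) * κ * (F * G) ≤ N := by
    rw [hF, Finset.sum_mul, Finset.mul_sum, hN]
    exact Finset.sum_le_sum fun i _ => by
      nlinarith [mul_le_mul_of_nonneg_right (hfG i).1 (hr i).le]
  -- No factor `e^K` is lost here, which gives `2K` rather than `3K` in the upper bound. `J` is the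
  -- relative entropy of the rescaled matrix with respect to `(N / L) Λ`, of equal mass, so `J ≥ 0`.
  -- As `u` is additive in `i` and `j`, its integral depends only on the margins, so it can be taken
  -- against `r i * c j` instead; `e^u ≥ 1 + u` then bounds `F * G` below.
  have hFG_ge : N ≤ κ * (F * G) := by
    set s := Real.log (N / L) with hs
    have hes : Real.exp s = N / L := Real.exp_log (by positivity)
    set u : Fin m → Fin n → ℝ := fun i j => α i + β j - s with hu
    have hB : ∀ i j, rescale α Λ β i j = N / L * Λ i j * Real.exp (u i j) := fun i j => by
      rw [rescale_apply, ← hes, hu, Real.exp_sub, Real.exp_add]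
      field_simp
    have hBsum : ∑ i, ∑ j, rescale α Λ β i j = N := by simp only [h.2.1, hN]
    set J := ∑ i, ∑ j, rescale α Λ β i j * u i j with hJ
    have hJ0 : 0 ≤ J := by
      have h1 : ∑ i, ∑ j, (rescale α Λ β i j - N / L * Λ i j) ≤ J :=
        Finset.sum_le_sum fun i _ => Finset.sum_le_sum fun j _ => by
          rw [hB]
          have hΛij := hΛ i j
          nlinarith [mul_le_mul_of_nonneg_left (one_le_exp_add_mul_exp (u i j))
            (show 0 ≤ N / L * Λ i j by positivity)]
      simp only [Finset.sum_sub_distrib, hBsum, ← Finset.mul_sum, ← hLsum] at h1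
      rw [div_mul_cancel₀ _ hL0.ne', sub_self] at h1
      exact h1
    have hJ1 : J = ∑ i, r i * α i + ∑ j, c j * β j - N * s := by
      simp only [hJ, hu, mul_sub, mul_add, Finset.sum_sub_distrib, Finset.sum_add_distrib,
        ← Finset.sum_mul, h.2.1]
      rw [Finset.sum_comm (f := fun i j => rescale α Λ β i j * β j)]
      simp only [← Finset.sum_mul, h.2.2, hN]
    have hJ2 : ∑ i, ∑ j, r i * c j * (1 + u i j) = N ^ 2 + N * J := by
      have h1 : ∀ i j, r i * c j * (1 + u i j) =
          r i * c j * (1 - s) + r i * α i * c j + r i * (c j * β j) := fun i j => by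
        simp only [hu]
        ring
      simp only [h1, Finset.sum_add_distrib, ← Finset.sum_mul, ← Finset.mul_sum, ← hrc, ← hN, hJ1]
      ring
    have hFG : F * G = N / L * ∑ i, ∑ j, r i * c j * Real.exp (u i j) := by
      rw [hF, hG, Finset.sum_mul_sum, Finset.mul_sum]
      refine Finset.sum_congr rfl fun i _ => ?_
      rw [Finset.mul_sum]
      refine Finset.sum_congr rfl fun j _ => ?_
      rw [← hes, hu, Real.exp_sub, Real.exp_add]
      simp only [hf, hg]
      field_simp
    have h2 : N ^ 2 ≤ ∑ i, ∑ j, r i * c j * Real.exp (u i j) := by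
      calc N ^ 2 ≤ N ^ 2 + N * J := le_add_of_nonneg_right (mul_nonneg hN0.le hJ0)
        _ ≤ _ := by
          rw [← hJ2]
          exact Finset.sum_le_sum fun i _ => Finset.sum_le_sum fun j _ =>
            mul_le_mul_of_nonneg_left (by linarith [Real.add_one_le_exp (u i j)])
              (mul_pos (hr i) (hc j)).le
    rw [hFG, hκ]
    calc N = L / N ^ 2 * (N / L * N ^ 2) := by field_simp
      _ ≤ _ := by gcongr
  have hexp : Real.exp (α i + β j) = f i * g j := Real.exp_add _ _
  have hNL : N / L = N⁻¹ * κ⁻¹ := by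
    rw [hκ]
    field_simp
  rw [hexp, hNL]
  have hNκ : 0 < N * κ := by positivity
  have hfg : 0 < f i * g j := mul_pos (hf0 i) (hg0 j)
  constructor
  · have h1 : (Real.exp (-K) * κ * (f i * G)) * (Real.exp (-K) * κ * (g j * F)) ≤ 1 :=
      mul_le_one₀ (hfG i).1 (by have := hg0 j; positivity) hgF.1
    have h2 : Real.exp (-K) * Real.exp (-K) = Real.exp (-(2 * K)) := by
      rw [← Real.exp_add]
      ring_nf
    have h3 : Real.exp (-(2 * K)) * ((f i * g j) * (N * κ)) ≤ 1 := by
      refine le_trans ?_ h1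
      calc _ ≤ Real.exp (-(2 * K)) * ((f i * g j) * (κ * (F * G) * κ)) := by gcongr
        _ = _ := by rw [← h2]; ring
    rw [← mul_inv, ← div_eq_mul_inv, le_div_iff₀ hNκ]
    rw [Real.exp_neg, inv_mul_le_iff₀ (Real.exp_pos _)] at h3
    linarith
  · have h1 : 1 ≤ (Real.exp K * κ * (f i * G)) * (Real.exp K * κ * (g j * F)) :=
      one_le_mul_of_one_le_of_one_le (hfG i).2 hgF.2
    have h2 : Real.exp K * Real.exp K * Real.exp K = Real.exp (3 * K) := by
      rw [← Real.exp_add, ← Real.exp_add]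
      ring_nf
    have h4 : κ * (F * G) ≤ Real.exp K * N := by
      rw [mul_assoc, Real.exp_neg, inv_mul_le_iff₀ (Real.exp_pos _)] at hFG_le
      exact hFG_le
    have h3 : 1 ≤ Real.exp (3 * K) * ((f i * g j) * (N * κ)) := by
      refine h1.trans ?_
      calc _ = Real.exp K * Real.exp K * ((f i * g j) * (κ * (F * G) * κ)) := by ring
        _ ≤ Real.exp K * Real.exp K * ((f i * g j) * (Real.exp K * N * κ)) := by gcongr
        _ = _ := by rw [← h2]; ring
    rw [← mul_inv, ← div_eq_mul_inv, div_le_iff₀ hNκ, Real.exp_neg,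
      inv_le_iff_one_le_mul₀' (Real.exp_pos _)]
    exact h3

/-! ### Stability of rescaling under a change of potentials. -/

lemma abs_exp_sub_one_le {x ρ : ℝ} (h : |x| ≤ ρ) : |Real.exp x - 1| ≤ Real.exp ρ - 1 := by
  obtain ⟨h1, h2⟩ := abs_le.1 h
  have h3 := Real.exp_le_exp.2 h1
  have h4 := Real.exp_le_exp.2 h2
  have h5 : 2 ≤ Real.exp ρ + Real.exp (-ρ) := by
    have := Real.one_le_cosh ρ
    rw [Real.cosh_eq] at this
    linarith
  exact abs_le.2 ⟨by linarith, by linarith⟩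

open scoped Matrix.Norms.L2Operator in
lemma norm_diagonal_le {ι : Type*} [Fintype ι] [DecidableEq ι] {v : ι → ℝ} {C : ℝ} (hC : 0 ≤ C)
    (h : ∀ i, |v i| ≤ C) : ‖Matrix.diagonal v‖ ≤ C := by
  rw [Matrix.l2_opNorm_diagonal]
  exact (pi_norm_le_iff_of_nonneg hC).2 h

open scoped Matrix.Norms.L2Operator in
/-- Stability of the rescaled matrix in spectral norm under a change of the potentials. -/
lemma spectralNorm_rescale_sub_le (hm : 0 < m) (hn : 0 < n) (Y : Matrix (Fin m) (Fin n) ℝ)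
    {α a : Fin m → ℝ} {β b : Fin n → ℝ} {C ρ₁ ρ₂ : ℝ} (hC : ∀ i j, Real.exp (α i + β j) ≤ C)
    (ha : ∀ i, |a i| ≤ ρ₁) (hb : ∀ j, |b j| ≤ ρ₂) :
    spectralNorm (rescale (α + a) Y (β + b) - rescale α Y β) ≤
      (Real.exp (ρ₁ + ρ₂) - 1) * (C * spectralNorm Y) := by
  have : Nonempty (Fin m) := ⟨⟨0, hm⟩⟩
  have : Nonempty (Fin n) := ⟨⟨0, hn⟩⟩
  have hρ₁ : 0 ≤ ρ₁ := (abs_nonneg _).trans (ha ⟨0, hm⟩)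
  have hρ₂ : 0 ≤ ρ₂ := (abs_nonneg _).trans (hb ⟨0, hn⟩)
  obtain ⟨i₁, hi₁⟩ := Finite.exists_max α
  obtain ⟨j₁, hj₁⟩ := Finite.exists_max β
  set Z := rescale α Y β with hZ
  have hZn : ‖Z‖ ≤ C * ‖Y‖ := by
    have h1 : ‖Matrix.diagonal fun i => Real.exp (α i)‖ ≤ Real.exp (α i₁) :=
      norm_diagonal_le (Real.exp_nonneg _) fun i => by
        rw [Real.abs_exp]
        exact Real.exp_le_exp.2 (hi₁ i)
    have h2 : ‖Matrix.diagonal fun j => Real.exp (β j)‖ ≤ Real.exp (β j₁) :=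
      norm_diagonal_le (Real.exp_nonneg _) fun j => by
        rw [Real.abs_exp]
        exact Real.exp_le_exp.2 (hj₁ j)
    calc ‖Z‖ ≤ ‖Matrix.diagonal (fun i => Real.exp (α i)) * Y‖ *
          ‖Matrix.diagonal fun j => Real.exp (β j)‖ := Matrix.l2_opNorm_mul _ _
      _ ≤ (Real.exp (α i₁) * ‖Y‖) * Real.exp (β j₁) := by
        refine mul_le_mul ((Matrix.l2_opNorm_mul _ _).trans ?_) h2 (norm_nonneg _) (by positivity)
        exact mul_le_mul_of_nonneg_right h1 (norm_nonneg _)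
      _ = Real.exp (α i₁ + β j₁) * ‖Y‖ := by rw [Real.exp_add]; ring
      _ ≤ _ := mul_le_mul_of_nonneg_right (hC _ _) (norm_nonneg _)
  -- Changing rows and columns one after the other makes the losses telescope: `(e^ρ₁ - 1) e^ρ₂ +
  -- (e^ρ₂ - 1) = e^(ρ₁ + ρ₂) - 1`.
  have hdecomp : rescale (α + a) Y (β + b) - Z =
      Matrix.diagonal (fun i => Real.exp (a i) - 1) * Z * Matrix.diagonal (fun j => Real.exp (b j)) +
        Z * Matrix.diagonal (fun j => Real.exp (b j) - 1) := by
    ext i j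
    simp only [Matrix.sub_apply, Matrix.add_apply, Matrix.mul_diagonal, Matrix.diagonal_mul, hZ,
      rescale_apply, Pi.add_apply, Real.exp_add]
    ring
  have h1 : ‖Matrix.diagonal fun i => Real.exp (a i) - 1‖ ≤ Real.exp ρ₁ - 1 :=
    norm_diagonal_le (sub_nonneg.2 (Real.one_le_exp hρ₁)) fun i => abs_exp_sub_one_le (ha i)
  have h2 : ‖Matrix.diagonal fun j => Real.exp (b j) - 1‖ ≤ Real.exp ρ₂ - 1 :=
    norm_diagonal_le (sub_nonneg.2 (Real.one_le_exp hρ₂)) fun j => abs_exp_sub_one_le (hb j)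
  have h3 : ‖Matrix.diagonal fun j => Real.exp (b j)‖ ≤ Real.exp ρ₂ :=
    norm_diagonal_le (Real.exp_nonneg _) fun j => by
      rw [Real.abs_exp]
      exact Real.exp_le_exp.2 (abs_le.1 (hb j)).2
  have hρ₁' : 0 ≤ Real.exp ρ₁ - 1 := sub_nonneg.2 (Real.one_le_exp hρ₁)
  change ‖rescale (α + a) Y (β + b) - Z‖ ≤ (Real.exp (ρ₁ + ρ₂) - 1) * (C * ‖Y‖)
  rw [hdecomp]
  calc _ ≤ ‖Matrix.diagonal (fun i => Real.exp (a i) - 1) * Z *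
        Matrix.diagonal (fun j => Real.exp (b j))‖ +
        ‖Z * Matrix.diagonal (fun j => Real.exp (b j) - 1)‖ := norm_add_le _ _
    _ ≤ (Real.exp ρ₁ - 1) * ‖Z‖ * Real.exp ρ₂ + ‖Z‖ * (Real.exp ρ₂ - 1) := by
      refine add_le_add ((Matrix.l2_opNorm_mul _ _).trans ?_) ((Matrix.l2_opNorm_mul _ _).trans ?_)
      · refine mul_le_mul ((Matrix.l2_opNorm_mul _ _).trans ?_) h3 (norm_nonneg _) (by positivity)
        exact mul_le_mul_of_nonneg_right h1 (norm_nonneg _)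
      · exact mul_le_mul_of_nonneg_left h2 (norm_nonneg _)
    _ = (Real.exp (ρ₁ + ρ₂) - 1) * ‖Z‖ := by rw [Real.exp_add]; ring
    _ ≤ _ := mul_le_mul_of_nonneg_left hZn
      (sub_nonneg.2 (Real.one_le_exp (add_nonneg hρ₁ hρ₂)))

/-- Stability of the rescaled matrix in entrywise `ℓ¹` norm under a change of the potentials. -/
lemma entryL1_rescale_sub_le {α a : Fin m → ℝ} {β b : Fin n → ℝ} {ρ : ℝ}
    (h : IsPotentials A r c (α + a) (β + b)) (hab : ∀ i j, |a i + b j| ≤ ρ) :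
    entryL1 (rescale (α + a) A (β + b) - rescale α A β) ≤ (Real.exp ρ - 1) * ∑ i, r i := by
  simp only [entryL1, ← h.2.1, Finset.mul_sum]
  refine Finset.sum_le_sum fun i _ => Finset.sum_le_sum fun j _ => ?_
  -- The difference is expressed through the new matrix, whose mass is exactly `∑ i, r i`, so no
  -- bound on the mass of `A` is needed.
  have h1 : (rescale (α + a) A (β + b) - rescale α A β) i j =
      -((Real.exp (-(a i + b j)) - 1) * rescale (α + a) A (β + b) i j) := by
    simp only [Matrix.sub_apply, rescale_apply, Pi.add_apply, neg_add, Real.exp_add, Real.exp_neg]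
    field_simp
    ring
  rw [h1, abs_neg, abs_mul, abs_of_nonneg (h.1 i j)]
  exact mul_le_mul_of_nonneg_right (abs_exp_sub_one_le (by rw [abs_neg]; exact hab i j)) (h.1 i j)

end Perturbation

/-! ### Constants, and the deterministic implication from good margins and alignment. -/

section Deterministic

variable {m n : ℕ} {r : Fin m → ℝ} {c : Fin n → ℝ} {Λ : Matrix (Fin m) (Fin n) ℝ}
  {δ K σ R D : ℝ}

lemma rescale_rescale (a α : Fin m → ℝ) (A : Matrix (Fin m) (Fin n) ℝ) (b β : Fin n → ℝ) :
    rescale a (rescale α A β) b = rescale (α + a) A (β + b) := by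
  ext i j
  simp only [rescale_apply, Pi.add_apply, Real.exp_add]
  ring

lemma IsSmoothMargin.row_pos (h : IsSmoothMargin r c δ) (i : Fin m) : 0 < r i := by
  have hm : (0 : ℝ) < m := Nat.cast_pos.2 i.pos
  have := h.delta_pos
  have := h.total_pos
  exact lt_of_lt_of_le (by positivity) (h.row i).1

lemma IsSmoothMargin.col_pos (h : IsSmoothMargin r c δ) (j : Fin n) : 0 < c j := by
  have hn : (0 : ℝ) < n := Nat.cast_pos.2 j.pos
  have := h.delta_pos
  have := h.total_pos
  exact lt_of_lt_of_le (by positivity) (h.col j).1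

lemma IsSmoothMargin.delta_le_one (h : IsSmoothMargin r c δ) (hm : 0 < m) : δ ≤ 1 := by
  have hm' : (0 : ℝ) < m := Nat.cast_pos.2 hm
  have h1 := h.delta_pos
  have h2 := h.total_pos
  have h3 := (h.row ⟨0, hm⟩).1.trans (h.row ⟨0, hm⟩).2
  rw [div_le_div_iff₀ hm' (by positivity)] at h3
  have h4 : δ ^ 2 * ((∑ i, r i) * m) ≤ 1 * ((∑ i, r i) * m) := by linarith
  have h5 := le_of_mul_le_mul_right h4 (by positivity)
  nlinarith

lemma one_le_maxDim (hm : 0 < m) : 1 ≤ maxDim m n :=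
  le_trans (by exact_mod_cast hm) (le_max_left _ _)

lemma tau_pos (hm : 0 < m) (hD : 0 < D) : 0 < tau m n D := by
  have h1 : 0 ≤ Real.log (maxDim m n) := Real.log_nonneg (one_le_maxDim hm)
  have h2 : 0 < Real.log 4 := Real.log_pos (by norm_num)
  unfold tau
  positivity

lemma tD_pos (hm : 0 < m) (hσ : 0 < σ) (hR : 0 < R) (hD : 0 < D) : 0 < tD m n σ R D := by
  have h1 := tau_pos (n := n) hm hD
  unfold tD
  positivity

lemma entryL1_pos (hm : 0 < m) (hn : 0 < n) (hΛ : ∀ i j, 0 < Λ i j) : 0 < entryL1 Λ :=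
  Finset.sum_pos (fun i _ => Finset.sum_pos (fun j _ => abs_pos.2 (hΛ i j).ne')
    ⟨⟨0, hn⟩, Finset.mem_univ _⟩) ⟨⟨0, hm⟩, Finset.mem_univ _⟩

lemma card_mul_entryMin_le (hΛ : ∀ i j, 0 < Λ i j) : m * n * entryMin Λ ≤ entryL1 Λ := by
  have h : ∑ _i : Fin m, ∑ _j : Fin n, entryMin Λ ≤ entryL1 Λ :=
    Finset.sum_le_sum fun i _ => Finset.sum_le_sum fun j _ => by
      rw [abs_of_pos (hΛ i j)]
      exact entryMin_le Λ i j
  simpa [mul_assoc] using h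

/-- The Doeblin constant of the rescaled model. -/
def doeblinConst (Λ : Matrix (Fin m) (Fin n) ℝ) (δ K : ℝ) : ℝ :=
  δ ^ 2 * entryMin Λ ^ 2 * (m : ℝ) ^ 2 * (n : ℝ) ^ 2 / (2 * Real.exp (8 * K) * entryL1 Λ ^ 2)

lemma doeblinConst_pos (hm : 0 < m) (hn : 0 < n) (hδ : 0 < δ) (hΛ : ∀ i j, 0 < Λ i j) :
    0 < doeblinConst Λ δ K := by
  have h1 := entryL1_pos hm hn hΛ
  have h2 := entryMin_pos hm hn hΛ
  have h3 : (0 : ℝ) < m := Nat.cast_pos.2 hm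
  have h4 : (0 : ℝ) < n := Nat.cast_pos.2 hn
  unfold doeblinConst
  positivity

lemma doeblinConst_le (hm : 0 < m) (hn : 0 < n) (hδ : 0 < δ) (hδ1 : δ ≤ 1) (hK : 0 ≤ K)
    (hΛ : ∀ i j, 0 < Λ i j) : doeblinConst Λ δ K ≤ δ / 2 := by
  have h1 := entryL1_pos hm hn hΛ
  have h2 := entryMin_pos hm hn hΛ
  have h3 : (0 : ℝ) < m := Nat.cast_pos.2 hm
  have h4 : (0 : ℝ) < n := Nat.cast_pos.2 hn
  have h5 : (m * n * entryMin Λ) ^ 2 ≤ entryL1 Λ ^ 2 :=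
    pow_le_pow_left₀ (by positivity) (card_mul_entryMin_le hΛ) 2
  have h6 : 1 ≤ Real.exp (8 * K) := Real.one_le_exp (by positivity)
  unfold doeblinConst
  rw [div_le_div_iff₀ (by positivity) (by norm_num)]
  calc _ = δ * 2 * (δ * (m * n * entryMin Λ) ^ 2) := by ring
    _ ≤ δ * 2 * (Real.exp (8 * K) * entryL1 Λ ^ 2) := by
      gcongr
      linarith
    _ = _ := by ring

/-- This identity explains `C_*`: it is one plus nine times the inverse Doeblin constant, so a
correction of order `ε₀ / η` is of order `C_* ε₀`. -/
lemma Cstar_mul_doeblinConst (hm : 0 < m) (hn : 0 < n) (hδ : 0 < δ) (hΛ : ∀ i j, 0 < Λ i j) :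
    (Cstar Λ δ K - 1) * doeblinConst Λ δ K = 9 := by
  have h1 := entryL1_pos hm hn hΛ
  have h2 := entryMin_pos hm hn hΛ
  have h3 : (0 : ℝ) < m := Nat.cast_pos.2 hm
  have h4 : (0 : ℝ) < n := Nat.cast_pos.2 hn
  unfold Cstar doeblinConst
  field_simp
  ring

lemma eps0_eq : eps0 Λ δ K σ R D = Real.exp (2 * K) * maxDim m n / (δ * entryL1 Λ) * tD m n σ R D :=
  rfl

lemma eps0_pos (hm : 0 < m) (hn : 0 < n) (hδ : 0 < δ) (hσ : 0 < σ) (hR : 0 < R) (hD : 0 < D)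
    (hΛ : ∀ i j, 0 < Λ i j) : 0 < eps0 Λ δ K σ R D := by
  have h1 := entryL1_pos hm hn hΛ
  have h2 := tD_pos (n := n) hm hσ hR hD
  have h3 := zero_lt_one.trans_le (one_le_maxDim (n := n) hm)
  rw [eps0_eq]
  positivity

lemma one_le_Cstar : 1 ≤ Cstar Λ δ K := le_add_of_nonneg_right (by positivity)

lemma epsPot_le_one (h : eps0 Λ δ K σ R D ≤ 1 / (50 * Cstar Λ δ K ^ 2)) :
    epsPot Λ δ K σ R D ≤ 1 := by
  have hC : 1 ≤ Cstar Λ δ K := one_le_Cstar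
  have h1 : 16 * Cstar Λ δ K * (1 / (50 * Cstar Λ δ K ^ 2)) ≤ 1 := by
    rw [mul_one_div, div_le_one (by positivity)]
    nlinarith
  exact (mul_le_mul_of_nonneg_left h (by positivity)).trans h1

lemma exp_sub_one_le_two_mul {x : ℝ} (h0 : 0 ≤ x) (h1 : x ≤ 1) : Real.exp x - 1 ≤ 2 * x := by
  have := (abs_le.1 (Real.abs_exp_sub_one_sub_id_le (abs_le.2 ⟨by linarith, h1⟩))).2
  nlinarith

/-- The weights that normalize the model `D(e^α) Λ D(e^β)` to have entries of size at most one. -/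
def modelWeight (Λ : Matrix (Fin m) (Fin n) ℝ) (r : Fin m → ℝ) (K : ℝ) (α : Fin m → ℝ)
    (β : Fin n → ℝ) : Matrix (Fin m) (Fin n) ℝ :=
  Matrix.of fun i j => Real.exp (α i + β j) / (Real.exp (2 * K) * ((∑ i, r i) / entryL1 Λ))

/-- The deterministic part: on the event that the weighted row and column sums of `x - Λ` are
small and distinct rows of `x` are aligned, `x` has potentials, and all of them are close to those
of `Λ`. -/
lemma potentials_close (hm : 0 < m) (hn : 0 < n) (hrc : IsSmoothMargin r c δ)
    (hΛ : ∀ i j, 0 < Λ i j) (hK : IsBoundedCost Λ r c K) (hσ : 0 < σ) (hR : 0 < R) (hD : 0 < D)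
    (hε : eps0 Λ δ K σ R D ≤ 1 / (50 * Cstar Λ δ K ^ 2)) {α : Fin m → ℝ} {β : Fin n → ℝ}
    (hαβ : IsPotentials Λ r c α β) {x : Matrix (Fin m) (Fin n) ℝ} (hx : ∀ i j, 0 ≤ x i j)
    (hrow : ∀ i, |∑ j, modelWeight Λ r K α β i j * (x i j - Λ i j)| ≤ tD m n σ R D)
    (hcol : ∀ j, |∑ i, modelWeight Λ r K α β i j * (x i j - Λ i j)| ≤ tD m n σ R D)
    (halign : ∀ i k, i ≠ k → n * entryMin Λ ^ 2 / 2 ≤ ∑ j, x i j * x k j) :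
    x ∈ scalable r c ∧ ∀ αX βX, IsPotentials x r c αX βX →
      ∃ (a : Fin m → ℝ) (b : Fin n → ℝ) (ρ₁ ρ₂ : ℝ), IsPotentials x r c (α + a) (β + b) ∧
        (∀ M : Matrix (Fin m) (Fin n) ℝ, rescale αX M βX = rescale (α + a) M (β + b)) ∧
        (∀ i, |a i| ≤ ρ₁) ∧ (∀ j, |b j| ≤ ρ₂) ∧ ρ₁ + ρ₂ ≤ epsPot Λ δ K σ R D := by
  set N := ∑ i, r i with hN
  set L := entryL1 Λ with hL
  set ε := eps0 Λ δ K σ R D with hεdef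
  set C := Cstar Λ δ K with hCdef
  set η := doeblinConst Λ δ K with hηdef
  have hmR : (0 : ℝ) < m := Nat.cast_pos.2 hm
  have hnR : (0 : ℝ) < n := Nat.cast_pos.2 hn
  have hδ := hrc.delta_pos
  have hN0 : 0 < N := hrc.total_pos
  have hL0 : 0 < L := entryL1_pos hm hn hΛ
  have hmin := entryMin_pos hm hn hΛ
  have hr := hrc.row_pos
  have hc := hrc.col_pos
  have hδ1 := hrc.delta_le_one hm
  have ht := tD_pos (n := n) hm hσ hR hD
  have hε0 : 0 < ε := eps0_pos hm hn hδ hσ hR hD hΛ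
  have hη0 : 0 < η := doeblinConst_pos hm hn hδ hΛ
  have hηδ : η ≤ δ / 2 := doeblinConst_le hm hn hδ hδ1 hK.K_nonneg hΛ
  have hCη : (C - 1) * η = 9 := Cstar_mul_doeblinConst hm hn hδ hΛ
  have hC2 : 10 ≤ C := by nlinarith
  have hεC : ε * (50 * C ^ 2) ≤ 1 := (le_div_iff₀ (by positivity)).1 hε
  have hbounds := hαβ.exp_bounds hΛ hr hc hrc.total_eq hK
  set B := Real.exp (2 * K) * (N / L) with hB
  have hB0 : 0 < B := by positivity
  set A := rescale α x β with hA
  have hAx : ∀ i j, A i j = Real.exp (α i + β j) * x i j := fun i j => by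
    rw [hA, rescale_apply, Real.exp_add]
    ring
  have hdiff : ∀ i j, A i j - rescale α Λ β i j =
      B * (modelWeight Λ r K α β i j * (x i j - Λ i j)) := fun i j => by
    rw [hAx, rescale_apply, modelWeight, Matrix.of_apply, ← hN, ← hL, ← hB, Real.exp_add]
    field_simp
  -- `ε₀` is by design the relative margin error: `B t_D = ε₀ δ N / (m ∨ n)`, and smoothness bounds
  -- every margin entry below by `δ N / d` with `d ≤ m ∨ n`.
  have hBt : ∀ (d : ℕ) (s : ℝ), 0 < d → (d : ℝ) ≤ maxDim m n → δ * N / d ≤ s →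
      B * tD m n σ R D ≤ ε * s := fun d s hd hdM hs => by
    have hdR : (0 : ℝ) < d := Nat.cast_pos.2 hd
    calc B * tD m n σ R D = B * tD m n σ R D * 1 := (mul_one _).symm
      _ ≤ B * tD m n σ R D * (maxDim m n / d) := by
        gcongr
        rwa [one_le_div hdR]
      _ = ε * (δ * N / d) := by
        rw [hεdef, eps0_eq, hB, ← hL]
        field_simp
      _ ≤ _ := by gcongr
  have hrow' : ∀ i, |∑ j, A i j - r i| ≤ ε * r i := fun i => by
    rw [← hαβ.2.1 i, ← Finset.sum_sub_distrib]
    simp only [hdiff, ← Finset.mul_sum]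
    rw [abs_mul, abs_of_pos hB0, hαβ.2.1 i]
    exact (mul_le_mul_of_nonneg_left (hrow i) hB0.le).trans
      (hBt m (r i) hm (le_max_left _ _) (hrc.row i).1)
  have hcol' : ∀ j, |∑ i, A i j - c j| ≤ ε * c j := fun j => by
    rw [← hαβ.2.2 j, ← Finset.sum_sub_distrib]
    simp only [hdiff, ← Finset.mul_sum]
    rw [abs_mul, abs_of_pos hB0, hαβ.2.2 j]
    exact (mul_le_mul_of_nonneg_left (hcol j) hB0.le).trans
      (hBt n (c j) hn (le_max_right _ _) (hrc.col j).1)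
  have hε1 : ε ≤ 1 / 100 := by nlinarith
  have hCε : C * ε ≤ 1 / 500 := by nlinarith
  have hA0 : ∀ i j, 0 ≤ A i j := fun i j => by
    rw [hAx]
    exact mul_nonneg (Real.exp_nonneg _) (hx i j)
  have hApos : ∀ i j, 0 < A i j ↔ 0 < x i j := fun i j => by
    rw [hAx]
    exact mul_pos_iff_of_pos_left (Real.exp_pos _)
  have hrowpos : ∀ i, ∃ j, 0 < A i j := fun i => by
    by_contra! hcon
    have h1 : ∑ j, A i j ≤ 0 := Finset.sum_nonpos fun j _ => hcon j
    have h2 := (abs_le.1 (hrow' i)).1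
    nlinarith [hr i]
  have hcolpos : ∀ j, ∃ i, 0 < A i j := fun j => by
    by_contra! hcon
    have h1 : ∑ i, A i j ≤ 0 := Finset.sum_nonpos fun i _ => hcon i
    have h2 := (abs_le.1 (hcol' j)).1
    nlinarith [hc j]
  have hconn : ∀ i k, ∃ j, 0 < x i j ∧ 0 < x k j := fun i k => by
    rcases eq_or_ne i k with rfl | hik
    · obtain ⟨j, hj⟩ := hrowpos i
      exact ⟨j, (hApos i j).1 hj, (hApos i j).1 hj⟩
    · have h1 : 0 < ∑ j, x i j * x k j := lt_of_lt_of_le (by positivity) (halign i k hik)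
      obtain ⟨j, -, hj⟩ := Finset.exists_lt_of_sum_lt (s := Finset.univ) (f := fun _ => (0 : ℝ))
        (g := fun j => x i j * x k j) (by simpa using h1)
      exact ⟨j, pos_of_mul_pos_left hj (hx k j), pos_of_mul_pos_right hj (hx i j)⟩
  -- For `i = k` this is Cauchy–Schwarz with the almost correct row sum. For `i ≠ k` it combines the
  -- inner product of rows of `x`, the lower bound on `e^(α i + β j)`, and `c j ≤ N / (δ n)`.
  have halign' : ∀ i k, η * r i / m ≤ ∑ j, A i j * A k j / c j := fun i k => by
    rcases eq_or_ne i k with rfl | hik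
    · have h1 := Finset.sq_sum_div_le_sum_sq_div Finset.univ (fun j => A i j) (g := c)
        fun j _ => hc j
      simp only [← sq]
      refine le_trans ?_ h1
      rw [← hrc.total_eq, ← hN, le_div_iff₀ hN0]
      have h2 : (1 - ε) * r i ≤ ∑ j, A i j := by linarith [(abs_le.1 (hrow' i)).1]
      have h3 := (hrc.row i).1
      have hri := hr i
      calc η * r i / m * N ≤ δ / 2 * r i / m * N := by gcongr
        _ = 1 / 2 * r i * (δ * N / m) := by ring
        _ ≤ 1 / 2 * r i * r i := by gcongr
        _ ≤ ((1 - ε) * r i) ^ 2 := by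
          have h4 : 1 / 2 ≤ (1 - ε) ^ 2 := by nlinarith
          calc _ = 1 / 2 * r i ^ 2 := by ring
            _ ≤ (1 - ε) ^ 2 * r i ^ 2 := by gcongr
            _ = _ := by ring
        _ ≤ _ := pow_le_pow_left₀ (mul_nonneg (by linarith) hri.le) h2 2
    · have hterm : ∀ j, (Real.exp (-(3 * K)) * (N / L)) ^ 2 * (δ * n / N) * (x i j * x k j) ≤
          A i j * A k j / c j := fun j => by
        have h1 : δ * n / N ≤ 1 / c j := by
          rw [div_le_div_iff₀ hN0 (hc j)]
          have := (hrc.col j).2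
          rw [le_div_iff₀ (by positivity)] at this
          linarith
        have h2 := (hbounds i j).2
        have h3 := (hbounds k j).2
        have hxx : 0 ≤ x i j * x k j := mul_nonneg (hx i j) (hx k j)
        calc _ = (Real.exp (-(3 * K)) * (N / L)) * (Real.exp (-(3 * K)) * (N / L)) *
              (δ * n / N) * (x i j * x k j) := by ring
          _ ≤ Real.exp (α i + β j) * Real.exp (α k + β j) * (1 / c j) * (x i j * x k j) := by
            gcongr
          _ = _ := by
            rw [hAx, hAx]
            ring
      refine le_trans ?_ (Finset.sum_le_sum fun j _ => hterm j)
      rw [← Finset.mul_sum]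
      refine le_trans ?_ (mul_le_mul_of_nonneg_left (halign i k hik) (by positivity))
      have h1 : r i ≤ N / (δ * m) := (hrc.row i).2
      -- Two lower bounds on the potentials cost `e^(-6K)`; the constant `η` allows for `e^(-8K)`.
      have h2 : (Real.exp (8 * K))⁻¹ ≤ Real.exp (-(3 * K)) ^ 2 := by
        rw [← Real.exp_neg, ← Real.exp_nat_mul, Real.exp_le_exp]
        push_cast
        linarith [hK.K_nonneg]
      calc η * r i / m ≤ η * (N / (δ * m)) / m := by gcongr
        _ = (Real.exp (8 * K))⁻¹ * ((N / L) ^ 2 * (δ * n / N) * (n * entryMin Λ ^ 2 / 2)) := by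
          rw [hηdef, doeblinConst, ← hL]
          field_simp
        _ ≤ Real.exp (-(3 * K)) ^ 2 * ((N / L) ^ 2 * (δ * n / N) * (n * entryMin Λ ^ 2 / 2)) := by
          gcongr
        _ = _ := by ring
  have hdata : SinkhornData A r c := ⟨hA0, hrowpos, hcolpos, hr, hc⟩
  -- With `ρ = 4 C_* ε₀` one has `η ρ ≥ 36 ε₀ ≥ 10 ε₀`, and the total correction `2ρ + 2ε₀ ≤ 10 C_*
  -- ε₀` stays below `ε_pot`.
  obtain ⟨a, b, hab, ha, hb⟩ := hdata.exists_isPotentials_near hm hrc.total_eq hε0.le hε1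
    (ρ := 4 * (C * ε)) (by positivity) (by linarith) hη0
    (by nlinarith) hrow' hcol' halign'
  have hpot : IsPotentials x r c (α + a) (β + b) := by
    rw [IsPotentials, hA, rescale_rescale] at hab
    exact hab
  refine ⟨⟨hx, fun i => Real.exp ((α + a) i), fun j => Real.exp ((β + b) j),
    fun i => Real.exp_pos _, fun j => Real.exp_pos _, hpot⟩, fun αX βX hX => ?_⟩
  refine ⟨a, b, 4 * (C * ε), 4 * (C * ε) + 2 * ε, hpot, fun M => ?_, ha, hb, ?_⟩
  · ext i j
    have h1 := hX.add_eq_add hconn (fun j => (hcolpos j).imp fun i => (hApos i j).1) hpot i j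
    rw [rescale_apply, rescale_apply, mul_right_comm, ← Real.exp_add, h1, Real.exp_add]
    ring
  · have h1 : ε ≤ C * ε := le_mul_of_one_le_left hε0.le (by linarith)
    rw [epsPot, ← hCdef, ← hεdef, mul_assoc]
    linarith

open scoped Matrix.Norms.L2Operator in
lemma spectralNorm_nonneg (A : Matrix (Fin m) (Fin n) ℝ) : 0 ≤ spectralNorm A := norm_nonneg A

lemma mem_eventSpectral_of_close {Ω : Type*} {X : Ω → Matrix (Fin m) (Fin n) ℝ} {ω : Ω}
    (hm : 0 < m) (hn : 0 < n) (hrc : IsSmoothMargin r c δ)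
    (hΛ : ∀ i j, 0 < Λ i j) (hK : IsBoundedCost Λ r c K)
    (hε : epsPot Λ δ K σ R D ≤ 1) {α : Fin m → ℝ} {β : Fin n → ℝ}
    (hαβ : IsPotentials Λ r c α β)
    (hclose : X ω ∈ scalable r c ∧ ∀ αX βX, IsPotentials (X ω) r c αX βX →
      ∃ (a : Fin m → ℝ) (b : Fin n → ℝ) (ρ₁ ρ₂ : ℝ), IsPotentials (X ω) r c (α + a) (β + b) ∧
        (∀ M : Matrix (Fin m) (Fin n) ℝ, rescale αX M βX = rescale (α + a) M (β + b)) ∧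
        (∀ i, |a i| ≤ ρ₁) ∧ (∀ j, |b j| ≤ ρ₂) ∧ ρ₁ + ρ₂ ≤ epsPot Λ δ K σ R D)
    (hspec : spectralNorm (X ω - Λ) ≤ tD m n σ R D) :
    ω ∈ eventSpectral X Λ r c α β δ K σ R D := by
  refine ⟨hclose.1, fun αX βX hX => ?_⟩
  obtain ⟨a, b, ρ₁, ρ₂, -, hM, ha, hb, hρ⟩ := hclose.2 αX βX hX
  have hN0 := hrc.total_pos
  have hL0 := entryL1_pos hm hn hΛ
  have hs0 : 0 ≤ spectralNorm (X ω - Λ) := spectralNorm_nonneg _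
  have hρ₁ : 0 ≤ ρ₁ := (abs_nonneg _).trans (ha ⟨0, hm⟩)
  have hρ₂ : 0 ≤ ρ₂ := (abs_nonneg _).trans (hb ⟨0, hn⟩)
  have hε0 : 0 ≤ epsPot Λ δ K σ R D := (add_nonneg hρ₁ hρ₂).trans hρ
  have h1 := spectralNorm_rescale_sub_le hm hn (X ω - Λ)
    (fun i j => (hαβ.exp_bounds hΛ hrc.row_pos hrc.col_pos hrc.total_eq hK i j).1) ha hb
  have h2 : Real.exp (ρ₁ + ρ₂) - 1 ≤ 2 * epsPot Λ δ K σ R D :=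
    (exp_sub_one_le_two_mul (add_nonneg hρ₁ hρ₂) (hρ.trans hε)).trans (by linarith)
  rw [hM, one_div, inv_mul_le_iff₀ hN0]
  refine h1.trans ?_
  calc _ ≤ 2 * epsPot Λ δ K σ R D * (Real.exp (2 * K) * ((∑ i, r i) / entryL1 Λ) *
        tD m n σ R D) := by gcongr
    _ ≤ 3 * epsPot Λ δ K σ R D * (Real.exp (2 * K) * ((∑ i, r i) / entryL1 Λ) *
        tD m n σ R D) := by
      have := hs0.trans hspec
      gcongr
      norm_num
    _ = _ := by ring

lemma mem_eventL1_of_close {Ω : Type*} {X : Ω → Matrix (Fin m) (Fin n) ℝ} {ω : Ω}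
    (hm : 0 < m) (hn : 0 < n) (hrc : IsSmoothMargin r c δ) (hK : 0 ≤ K)
    (hε : epsPot Λ δ K σ R D ≤ 1) {α : Fin m → ℝ} {β : Fin n → ℝ}
    (hclose : X ω ∈ scalable r c ∧ ∀ αX βX, IsPotentials (X ω) r c αX βX →
      ∃ (a : Fin m → ℝ) (b : Fin n → ℝ) (ρ₁ ρ₂ : ℝ), IsPotentials (X ω) r c (α + a) (β + b) ∧
        (∀ M : Matrix (Fin m) (Fin n) ℝ, rescale αX M βX = rescale (α + a) M (β + b)) ∧
        (∀ i, |a i| ≤ ρ₁) ∧ (∀ j, |b j| ≤ ρ₂) ∧ ρ₁ + ρ₂ ≤ epsPot Λ δ K σ R D) :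
    ω ∈ eventL1 X Λ r c α β δ K σ R D := by
  refine ⟨hclose.1, fun αX βX hX => ?_⟩
  obtain ⟨a, b, ρ₁, ρ₂, hpot, hM, ha, hb, hρ⟩ := hclose.2 αX βX hX
  have hN0 := hrc.total_pos
  have hρ₁ : 0 ≤ ρ₁ := (abs_nonneg _).trans (ha ⟨0, hm⟩)
  have hρ₂ : 0 ≤ ρ₂ := (abs_nonneg _).trans (hb ⟨0, hn⟩)
  have hε0 : 0 ≤ epsPot Λ δ K σ R D := (add_nonneg hρ₁ hρ₂).trans hρ
  have h1 := entryL1_rescale_sub_le hpot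
    fun i j => (abs_add_le (a i) (b j)).trans (add_le_add (ha i) (hb j))
  have h2 : Real.exp (ρ₁ + ρ₂) - 1 ≤ 2 * epsPot Λ δ K σ R D :=
    (exp_sub_one_le_two_mul (add_nonneg hρ₁ hρ₂) (hρ.trans hε)).trans (by linarith)
  have h3 : 1 ≤ Real.exp (2 * K) := Real.one_le_exp (by positivity)
  rw [hM, one_div, inv_mul_le_iff₀ hN0]
  refine h1.trans ?_
  calc _ ≤ 2 * epsPot Λ δ K σ R D * ∑ i, r i := by gcongr
    _ ≤ 2 * epsPot Λ δ K σ R D * Real.exp (2 * K) * ∑ i, r i :=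
      mul_le_mul_of_nonneg_right (le_mul_of_one_le_right (by positivity) h3) hN0.le
    _ = _ := by ring

end Deterministic

/-! ### Probabilities of the exceptional sets. -/

section Probability

variable {Ω : Type*} [MeasurableSpace Ω] {μ : Measure Ω} {m n : ℕ}
  {X : Ω → Matrix (Fin m) (Fin n) ℝ} {Λ : Matrix (Fin m) (Fin n) ℝ} {σ R D : ℝ}

/-- This is the reason for the form of `τ`: `m + n` two-sided bounds of size `2 e^(-τ)` add up to at
most `(m ∨ n)^(-D)`. -/
lemma maxDim_mul_exp_neg_tau (hm : 0 < m) :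
    maxDim m n * Real.exp (-tau m n D) = maxDim m n ^ (-D) / 4 := by
  have hM : 0 < maxDim m n := zero_lt_one.trans_le (one_le_maxDim hm)
  have h1 : Real.exp (-tau m n D) = maxDim m n ^ (-D) * (maxDim m n)⁻¹ * 4⁻¹ := by
    rw [Real.rpow_def_of_pos hM, tau]
    conv_rhs => rw [← Real.exp_log hM, ← Real.exp_log (show (0 : ℝ) < 4 by norm_num)]
    rw [Real.log_exp, ← Real.exp_neg, ← Real.exp_neg, ← Real.exp_add, ← Real.exp_add]
    congr 1
    ring
  rw [h1]
  field_simp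

/-- Weighted row and column sums of `X - Λ` are uniformly small with high probability. -/
lemma measureReal_margins_ge_le (hX : IsSubexponential μ X Λ σ R) (hm : 0 < m) (hD : 0 < D)
    {w : Matrix (Fin m) (Fin n) ℝ} (hw : ∀ i j, |w i j| ≤ 1) :
    μ.real ((⋃ i, {ω | tD m n σ R D ≤ |∑ j, w i j * (X ω i j - Λ i j)|}) ∪
      ⋃ j, {ω | tD m n σ R D ≤ |∑ i, w i j * (X ω i j - Λ i j)|}) ≤ maxDim m n ^ (-D) := by
  have hM : 0 < maxDim m n := zero_lt_one.trans_le (one_le_maxDim hm)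
  have hτ := tau_pos (n := n) hm hD
  have key : ∀ s : Finset (Fin m × Fin n), (s.card : ℝ) ≤ maxDim m n →
      μ.real {ω | tD m n σ R D ≤ |∑ e ∈ s, centredEntry X Λ w e ω|} ≤
        2 * Real.exp (-tau m n D) := fun s hs =>
    measureReal_abs_sum_ge_le hX.sigma_pos hX.R_pos hM hτ (iIndepFun_centredEntry hX w)
      (measurable_centredEntry hX w) (integrable_centredEntry_pow hX w)
      (abs_integral_centredEntry_pow_le hX hw) s hs
  have hrow : ∀ i, μ.real {ω | tD m n σ R D ≤ |∑ j, w i j * (X ω i j - Λ i j)|} ≤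
      2 * Real.exp (-tau m n D) := fun i => by
    have h := key ({i} ×ˢ Finset.univ) (by simp [maxDim])
    simpa only [Finset.sum_product, Finset.sum_singleton, centredEntry] using h
  have hcol : ∀ j, μ.real {ω | tD m n σ R D ≤ |∑ i, w i j * (X ω i j - Λ i j)|} ≤
      2 * Real.exp (-tau m n D) := fun j => by
    have h := key (Finset.univ ×ˢ {j}) (by simp [maxDim])
    simpa only [Finset.sum_product, Finset.sum_singleton, centredEntry] using h
  refine (measureReal_union_le _ _).trans ?_
  have h1 := (measureReal_iUnion_fintype_le (μ := μ) fun i =>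
    {ω | tD m n σ R D ≤ |∑ j, w i j * (X ω i j - Λ i j)|}).trans
    (Finset.sum_le_sum fun i _ => hrow i)
  have h2 := (measureReal_iUnion_fintype_le (μ := μ) fun j =>
    {ω | tD m n σ R D ≤ |∑ i, w i j * (X ω i j - Λ i j)|}).trans
    (Finset.sum_le_sum fun j _ => hcol j)
  rw [Finset.sum_const, Finset.card_univ, Fintype.card_fin, nsmul_eq_mul] at h1 h2
  have h3 := maxDim_mul_exp_neg_tau (n := n) (D := D) hm
  have h4 : (m : ℝ) * (2 * Real.exp (-tau m n D)) ≤
      maxDim m n * (2 * Real.exp (-tau m n D)) := by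
    gcongr
    exact le_max_left _ _
  have h5 : (n : ℝ) * (2 * Real.exp (-tau m n D)) ≤
      maxDim m n * (2 * Real.exp (-tau m n D)) := by
    gcongr
    exact le_max_right _ _
  linarith

lemma measureReal_spectral_ge_le (hX : IsSubexponential μ X Λ σ R) (hm : 0 < m) (hD : 0 < D) :
    μ.real {ω | tD m n σ R D ≤ spectralNorm (X ω - Λ)} ≤ maxDim m n ^ (-D) := by
  have hM : 0 < maxDim m n := zero_lt_one.trans_le (one_le_maxDim hm)
  set w : Matrix (Fin m) (Fin n) ℝ := Matrix.of fun _ _ => 1 with hw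
  have h := measureReal_spectralNorm_ge_le hX.sigma_pos hX.R_pos hm (tau_pos (n := n) hm hD)
    (iIndepFun_centredEntry hX w) (measurable_centredEntry hX w)
    (integrable_centredEntry_pow hX w)
    (abs_integral_centredEntry_pow_le hX (w := w) (by simp [hw]))
  have h1 : ∀ ω, (Matrix.of fun i j => centredEntry X Λ w (i, j) ω) = X ω - Λ := fun ω => by
    ext i j
    simp [centredEntry, hw]
  simp only [h1] at h
  refine h.trans ?_
  have h3 := maxDim_mul_exp_neg_tau (n := n) (D := D) hm
  have h4 : (m : ℝ) * (2 * Real.exp (-tau m n D)) ≤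
      maxDim m n * (2 * Real.exp (-tau m n D)) := by
    gcongr
    exact le_max_left _ _
  have h5 : 0 < maxDim m n ^ (-D) := Real.rpow_pos_of_pos hM _
  linarith

lemma measureReal_rows_le (hX : IsSubexponential μ X Λ σ R) (hn : 0 < n) :
    μ.real (⋃ p : Fin m × Fin m, {ω | p.1 ≠ p.2 ∧
      ∑ j, X ω p.1 j * X ω p.2 j ≤ n * entryMin Λ ^ 2 / 2}) ≤
      (m : ℝ) ^ 2 * Real.exp (-(1 / 8) * alignRate Λ σ R) := by
  refine (measureReal_iUnion_fintype_le _).trans ?_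
  have h : ∀ p ∈ (Finset.univ : Finset (Fin m × Fin m)), μ.real {ω | p.1 ≠ p.2 ∧
      ∑ j, X ω p.1 j * X ω p.2 j ≤ n * entryMin Λ ^ 2 / 2} ≤
      Real.exp (-(1 / 8) * alignRate Λ σ R) := fun p _ => by
    by_cases hp : p.1 = p.2
    · simpa [hp] using Real.exp_nonneg _
    · simpa [hp] using measureReal_row_inner_le hX hn hp
  refine (Finset.sum_le_card_nsmul _ _ _ h).trans_eq ?_
  rw [Finset.card_univ, Fintype.card_prod, Fintype.card_fin, nsmul_eq_mul]
  push_cast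
  ring

end Probability

end SinkhornRescaling

end

/-! ### Assembly of the theorem. -/

open SinkhornRescaling in
theorem mainTheorem10 :
    ∃ c₀ : ℝ, 0 < c₀ ∧
      ∀ {Ω : Type*} [MeasurableSpace Ω] (μ : Measure Ω) [IsProbabilityMeasure μ]
        (m n : ℕ) (_ : 0 < m) (_ : 0 < n)
        (X : Ω → Matrix (Fin m) (Fin n) ℝ) (Λ : Matrix (Fin m) (Fin n) ℝ)
        (r : Fin m → ℝ) (c : Fin n → ℝ) (δ K σ R D : ℝ),
        SinkhornRescaling.IsSmoothMargin r c δ →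
        SinkhornRescaling.IsSubexponential μ X Λ σ R →
        SinkhornRescaling.IsBoundedCost Λ r c K →
        0 < D →
        SinkhornRescaling.eps0 Λ δ K σ R D ≤ 1 / (50 * SinkhornRescaling.Cstar Λ δ K ^ 2) →
        SinkhornRescaling.epsPot Λ δ K σ R D ≤ 1 ∧
        (∃ (α : Fin m → ℝ) (β : Fin n → ℝ), SinkhornRescaling.IsPotentials Λ r c α β) ∧
        ∀ (α : Fin m → ℝ) (β : Fin n → ℝ), SinkhornRescaling.IsPotentials Λ r c α β →
          1 - 2 * SinkhornRescaling.maxDim m n ^ (-D)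
              - (m : ℝ) ^ 2 * Real.exp (-c₀ * SinkhornRescaling.alignRate Λ σ R)
            ≤ μ.real (SinkhornRescaling.eventSpectral X Λ r c α β δ K σ R D) ∧
          1 - SinkhornRescaling.maxDim m n ^ (-D)
              - (m : ℝ) ^ 2 * Real.exp (-c₀ * SinkhornRescaling.alignRate Λ σ R)
              - 2 * Real.exp (-((SinkhornRescaling.entryL1 Λ ^ 2 / 2) /
                  ((m : ℝ) * n * σ ^ 2 + R * SinkhornRescaling.entryL1 Λ)))
            ≤ μ.real (SinkhornRescaling.eventL1 X Λ r c α β δ K σ R D) := by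
  -- `1 / 8` is the rate from the lower tail for inner products of rows.
  refine ⟨1 / 8, by norm_num, ?_⟩
  intro Ω _ μ _ m n hm hn X Λ r c δ K σ R D hrc hX hK hD hε
  have hpot := epsPot_le_one hε
  refine ⟨hpot, exists_isPotentials_of_pos hm hn hX.mean_pos hrc.row_pos hrc.col_pos hrc.total_eq,
    fun α β hαβ => ?_⟩
  have hw : ∀ i j, |modelWeight Λ r K α β i j| ≤ 1 := fun i j => by
    have hN0 := hrc.total_pos
    have hL0 := entryL1_pos hm hn hX.mean_pos
    have h := (hαβ.exp_bounds hX.mean_pos hrc.row_pos hrc.col_pos hrc.total_eq hK i j).1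
    rw [modelWeight, Matrix.of_apply, abs_of_nonneg (by positivity), div_le_one (by positivity)]
    exact h
  set S₀ : Set Ω := {ω | ¬ ∀ i j, 0 ≤ X ω i j} with hS₀
  set S₁ : Set Ω :=
    (⋃ i, {ω | tD m n σ R D ≤ |∑ j, modelWeight Λ r K α β i j * (X ω i j - Λ i j)|}) ∪
      ⋃ j, {ω | tD m n σ R D ≤ |∑ i, modelWeight Λ r K α β i j * (X ω i j - Λ i j)|} with hS₁
  set S₂ : Set Ω := ⋃ p : Fin m × Fin m, {ω | p.1 ≠ p.2 ∧
      ∑ j, X ω p.1 j * X ω p.2 j ≤ n * entryMin Λ ^ 2 / 2} with hS₂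
  set S₃ : Set Ω := {ω | tD m n σ R D ≤ spectralNorm (X ω - Λ)} with hS₃
  have h0 : μ.real S₀ = 0 := by
    rw [measureReal_eq_zero_iff]
    exact ae_iff.1 hX.nonneg
  have h1 : μ.real S₁ ≤ maxDim m n ^ (-D) := measureReal_margins_ge_le hX hm hD hw
  have h2 : μ.real S₂ ≤ (m : ℝ) ^ 2 * Real.exp (-(1 / 8) * alignRate Λ σ R) :=
    measureReal_rows_le hX hn
  have h3 : μ.real S₃ ≤ maxDim m n ^ (-D) := measureReal_spectral_ge_le hX hm hD
  have hclose := fun (ω : Ω) (hω₀ : ω ∉ S₀) (hω₁ : ω ∉ S₁) (hω₂ : ω ∉ S₂) =>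
    potentials_close hm hn hrc hX.mean_pos hK hX.sigma_pos hX.R_pos hD hε hαβ (x := X ω)
      (by simpa [hS₀] using hω₀)
      (fun i => by
        by_contra hcon
        exact hω₁ (.inl (Set.mem_iUnion.2 ⟨i, (not_le.1 hcon).le⟩)))
      (fun j => by
        by_contra hcon
        exact hω₁ (.inr (Set.mem_iUnion.2 ⟨j, (not_le.1 hcon).le⟩)))
      (fun i k hik => by
        by_contra hcon
        exact hω₂ (Set.mem_iUnion.2 ⟨(i, k), hik, (not_le.1 hcon).le⟩))
  -- The last error term in the `ℓ¹` bound serves only as slack: the difference is measured against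
  -- the rescaled matrix of mass `N`, so `‖X‖₁` needs no concentration.
  have hexp := Real.exp_pos (-((entryL1 Λ ^ 2 / 2) / ((m : ℝ) * n * σ ^ 2 + R * entryL1 Λ)))
  constructor
  -- Subadditivity is applied to a cover of the whole space, so measurability of the event is not
  -- needed.
  · have hcover : Set.univ ⊆
        eventSpectral X Λ r c α β δ K σ R D ∪ (S₀ ∪ (S₁ ∪ (S₂ ∪ S₃))) := fun ω _ => by
      by_contra hcon
      simp only [Set.mem_union, not_or] at hcon
      obtain ⟨hE, hω₀, hω₁, hω₂, hω₃⟩ := hcon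
      exact hE (mem_eventSpectral_of_close hm hn hrc hX.mean_pos hK hpot hαβ
        (hclose ω hω₀ hω₁ hω₂) (not_le.1 hω₃).le)
    have h4 := measureReal_mono (μ := μ) hcover
    rw [probReal_univ] at h4
    have h5 := measureReal_union_le (μ := μ) (eventSpectral X Λ r c α β δ K σ R D)
      (S₀ ∪ (S₁ ∪ (S₂ ∪ S₃)))
    have h6 := measureReal_union_le (μ := μ) S₀ (S₁ ∪ (S₂ ∪ S₃))
    have h7 := measureReal_union_le (μ := μ) S₁ (S₂ ∪ S₃)
    have h8 := measureReal_union_le (μ := μ) S₂ S₃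
    linarith
  · have hcover : Set.univ ⊆
        eventL1 X Λ r c α β δ K σ R D ∪ (S₀ ∪ (S₁ ∪ S₂)) := fun ω _ => by
      by_contra hcon
      simp only [Set.mem_union, not_or] at hcon
      obtain ⟨hE, hω₀, hω₁, hω₂⟩ := hcon
      exact hE (mem_eventL1_of_close hm hn hrc hK.K_nonneg hpot (hclose ω hω₀ hω₁ hω₂))
    have h4 := measureReal_mono (μ := μ) hcover
    rw [probReal_univ] at h4
    have h5 := measureReal_union_le (μ := μ) (eventL1 X Λ r c α β δ K σ R D) (S₀ ∪ (S₁ ∪ S₂))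
    have h6 := measureReal_union_le (μ := μ) S₀ (S₁ ∪ S₂)
    have h7 := measureReal_union_le (μ := μ) S₁ S₂
    linarith
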